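/- Let $N\in\mathbb N$ and let $\omega:[0,\infty)\to[0,\infty)$ be a weight function, that is, a continuous increasing (not necessarily strictly) function such that ($\alpha$) $\omega(2t)\le K(1+\omega(t))$ for all $t\ge0$, for some $K\ge1$; ($\beta$) $\omega(t)=o(t)$ as $t\to\infty$; ($\gamma$) $\omega(t)\ge a+b\log(1+t)$ for all $t\ge 0$, for some $a\in\mathbb R$, $b>0$; ($\delta$) $t\mapsto\omega(e^t)$ is convex on $\mathbb R$. Fix constants $K$ and $b$ as in ($\alpha$) and ($\gamma$), and put $\omega(z)=\omega(|z|)$ for $z\in\mathbb R^N$ or $z\in\mathbb R^{2N}$, with $|\cdot|$ the Euclidean norm. Let $\hat f(\xi)=\int_{\mathbb R^N}e^{-ix\xi}f(x)\,dx$, and let $\mathcal S_\omega(\mathbb R^N)$ be the space of all $f\in L^1(\mathbb R^N)$ with $f,\hat f\in C^\infty(\mathbb R^N)$ and $\|e^{\lambda\omega}\partial^\alpha f\|_\infty<\infty$, $\|e^{\lambda\omega}\partial^\alpha\hat f\|_\infty<\infty$ for all $\lambda>0$ and all multi-indices $\alpha$. For $f\in\mathcal S_\omega(\mathbb R^N)$,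 $\tau\in[0,1]$ and $x,\xi\in\mathbb R^N$ let $$Rf(x,\xi)=e^{-ix\xi}f(x)\overline{\hat f(\xi)},\qquad \mathrm{Wig}_\tau(f)(x,\xi)=\int_{\mathbb R^N}e^{-it\xi}f(x+\tau t)\overline{f(x-(1-\tau)t)}\,dt .$$ Let $1\le p\le\infty$, let $q'$ denote the conjugate exponent of $q\in[1,\infty]$ (so $(2p)'=1$ for $p=\infty$), and let $\tau\in(0,1)$. Norms of $Rf$ and $\mathrm{Wig}_\tau(f)$ are taken over $\mathbb R^{2N}$. (i) For every $\lambda\ge0$ and $f\in\mathcal S_\omega(\mathbb R^N)$, $$\|e^{\lambda\omega}\mathrm{Wig}_\tau(f)\|_\infty^2\le D^{(3)}_\lambda\,\|e^{4K^2\lambda\omega}Rf\|_p\,\|e^{4K^2\lambda\omega}Rf\|_{p'},\qquad D^{(3)}_\lambda=\frac{e^{K(1+2K)\lambda}}{(2\pi)^N(\tau-\tau^2)^N},$$ and the two norms on the right are finite. (ii) For every $\lambda\ge0$, $\mu>\frac{2N}{b\,(2p)'}$ and $f\in\mathcal S_\omega(\mathbb R^N)$, $$\|e^{\lambda\omega}Rf\|_\infty\le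 D^{(4)}_{\lambda,\mu}\,\|e^{2K(K^2\lambda+\mu)\omega}\mathrm{Wig}_\tau(f)\|_p,$$ where, with $\tilde g(t)=g(-t)$, $$D^{(4)}_{\lambda,\mu}=\inf_{g\in\mathcal S_\omega(\mathbb R^N),\ g\ne0}\Big[D^{(2)}_{\lambda,\mu}(g)\,e^{2K(K^2\lambda+\mu)}\,\|e^{2K(K^2\lambda+\mu)\omega}\mathrm{Wig}_{1-\tau}(\tilde g)\|_{1}\Big],$$ $$D^{(2)}_{\lambda,\mu}(g)=\frac{e^{K(1+2K)\lambda}\,\|e^{K^2\lambda\omega}g\|_\infty\,\|e^{K^2\lambda\omega}\hat g\|_\infty\,\|e^{-\mu\omega}\|^2_{L^{(2p)'}(\mathbb R^{2N})}}{(2\pi)^{2N}\|g\|_2^4};$$ moreover $D^{(4)}_{\lambda,\mu}$ and the norm on the right are finite. -/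

import Mathlib

noncomputable section

namespace TimeFreq

open MeasureTheory Filter Asymptotics
open scoped ENNReal ComplexConjugate

/-- Weight functions `ω : [0,∞) → [0,∞)` in the sense of Braun, Meise and Taylor, together with
constants `K` and `b` that are admissible in the conditions `(α)` and `(γ)`.
Only the values of `ω` on `[0,∞)` matter. -/
structure IsWeight (ω : ℝ → ℝ) (K b : ℝ) : Prop where
  continuousOn : ContinuousOn ω (Set.Ici 0)
  monotoneOn : MonotoneOn ω (Set.Ici 0)
  nonneg : ∀ t, 0 ≤ t → 0 ≤ ω t
  one_le : 1 ≤ K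
  alpha : ∀ t, 0 ≤ t → ω (2 * t) ≤ K * (1 + ω t)
  beta : ω =o[atTop] (fun t : ℝ => t)
  pos : 0 < b
  gamma : ∃ a : ℝ, ∀ t, 0 ≤ t → a + b * Real.log (1 + t) ≤ ω t
  delta : ConvexOn ℝ Set.univ (fun t : ℝ => ω (Real.exp t))

/-- The Fourier transform `f̂(ξ) = ∫ e^{-i x·ξ} f(x) dx`. -/
def fourierT {N : ℕ} (f : EuclideanSpace ℝ (Fin N) → ℂ) (ξ : EuclideanSpace ℝ (Fin N)) : ℂ :=
  ∫ x, Complex.exp (-(Complex.I * (inner ℝ x ξ : ℝ))) * f x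

/-- The partial derivative `∂_i f`. -/
def partialDeriv {N : ℕ} (i : Fin N) (f : EuclideanSpace ℝ (Fin N) → ℂ) :
    EuclideanSpace ℝ (Fin N) → ℂ :=
  fun x => fderiv ℝ f x (EuclideanSpace.single i 1)

/-- The iterated partial derivative `∂_{i₁} ⋯ ∂_{iₙ} f` for a list `[i₁, …, iₙ]`. For smooth `f`
these are exactly the derivatives `∂^α f` over all multi-indices `α`. -/
def iterPartialDeriv {N : ℕ} (l : List (Fin N)) (f : EuclideanSpace ℝ (Fin N) → ℂ) :
    EuclideanSpace ℝ (Fin N) → ℂ :=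
  l.foldr partialDeriv f

/-- Membership in Björck's space `𝒮_ω(ℝ^N)`: `f ∈ L¹`, `f` and `f̂` are smooth, and
`e^{sω} ∂^α f`, `e^{sω} ∂^α f̂` are bounded for all `s > 0` and all `α`. -/
structure MemS {N : ℕ} (ω : ℝ → ℝ) (f : EuclideanSpace ℝ (Fin N) → ℂ) : Prop where
  integrable : Integrable f
  smooth : ContDiff ℝ (⊤ : ℕ∞) f
  smooth_fourier : ContDiff ℝ (⊤ : ℕ∞) (fourierT f)
  bound : ∀ s : ℝ, 0 < s → ∀ l : List (Fin N), ∃ C : ℝ, ∀ x,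
    Real.exp (s * ω ‖x‖) * ‖iterPartialDeriv l f x‖ ≤ C
  bound_fourier : ∀ s : ℝ, 0 < s → ∀ l : List (Fin N), ∃ C : ℝ, ∀ ξ,
    Real.exp (s * ω ‖ξ‖) * ‖iterPartialDeriv l (fourierT f) ξ‖ ≤ C

/-- The Rihaczek form `Rf(x,ξ) = e^{-i x·ξ} f(x) conj(f̂(ξ))`. -/
def rihaczek {N : ℕ} (f : EuclideanSpace ℝ (Fin N) → ℂ)
    (z : EuclideanSpace ℝ (Fin N) × EuclideanSpace ℝ (Fin N)) : ℂ :=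
  Complex.exp (-(Complex.I * (inner ℝ z.1 z.2 : ℝ))) * f z.1 * conj (fourierT f z.2)

/-- The `τ`-Wigner transform
`Wig_τ f(x,ξ) = ∫ e^{-i t·ξ} f(x + τt) conj(f(x - (1-τ)t)) dt`. -/
def tauWigner {N : ℕ} (τ : ℝ) (f : EuclideanSpace ℝ (Fin N) → ℂ)
    (z : EuclideanSpace ℝ (Fin N) × EuclideanSpace ℝ (Fin N)) : ℂ :=
  ∫ t, Complex.exp (-(Complex.I * (inner ℝ t z.2 : ℝ))) * f (z.1 + τ • t)
    * conj (f (z.1 - (1 - τ) • t))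

/-- The Euclidean norm of `z = (x,ξ)` in `ℝ^{2N}` (Mathlib's norm on a product is the maximum). -/
def phaseNorm {N : ℕ} (z : EuclideanSpace ℝ (Fin N) × EuclideanSpace ℝ (Fin N)) : ℝ :=
  Real.sqrt (‖z.1‖ ^ 2 + ‖z.2‖ ^ 2)

/-- `‖e^{sω} f‖_p` on `ℝ^N`. -/
def wnorm {N : ℕ} (ω : ℝ → ℝ) (s : ℝ) (p : ℝ≥0∞) (f : EuclideanSpace ℝ (Fin N) → ℂ) : ℝ≥0∞ :=
  eLpNorm (fun x => (Real.exp (s * ω ‖x‖) : ℂ) * f x) p volume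

/-- `‖e^{sω} F‖_p` on `ℝ^{2N}`. -/
def wnorm2 {N : ℕ} (ω : ℝ → ℝ) (s : ℝ) (p : ℝ≥0∞)
    (F : EuclideanSpace ℝ (Fin N) × EuclideanSpace ℝ (Fin N) → ℂ) : ℝ≥0∞ :=
  eLpNorm (fun z => (Real.exp (s * ω (phaseNorm z)) : ℂ) * F z) p volume

/-- The constant `D⁽³⁾_s`, for `s ≥ 0` and `0 < τ < 1`. -/
def D3 (N : ℕ) (K τ s : ℝ) : ℝ :=
  Real.exp (K * (1 + 2 * K) * s) / ((2 * Real.pi) ^ N * (τ - τ ^ 2) ^ N)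

/-- The constant `D⁽²⁾_{s,μ}` of the window `g`, where `(2p)'` is the exponent conjugate to `2p`:
`e^{K(1+2K)s} ‖e^{K²sω} g‖_∞ ‖e^{K²sω} ĝ‖_∞ ‖e^{-μω}‖²_{L^{(2p)'}(ℝ^{2N})} / ((2π)^{2N} ‖g‖₂⁴)`. -/
def D2 {N : ℕ} (ω : ℝ → ℝ) (K : ℝ) (p : ℝ≥0∞) (s μ : ℝ) (g : EuclideanSpace ℝ (Fin N) → ℂ) :
    ℝ≥0∞ :=
  ENNReal.ofReal (Real.exp (K * (1 + 2 * K) * s))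
    * wnorm ω (K ^ 2 * s) ⊤ g * wnorm ω (K ^ 2 * s) ⊤ (fourierT g)
    * wnorm2 (N := N) ω (-μ) (2 * p).conjExponent (fun _ => 1) ^ 2
    / (ENNReal.ofReal ((2 * Real.pi) ^ (2 * N)) * eLpNorm g 2 volume ^ 4)

/-- The constant `D⁽⁴⁾_{s,μ}`: the infimum over all windows `g ∈ 𝒮_ω(ℝ^N)`, `g ≠ 0`, of
`D⁽²⁾_{s,μ} e^{2K(K²s+μ)} ‖e^{2K(K²s+μ)ω} Wig_{1-τ}(g̃)‖₁` with `g̃(t) = g(-t)`. -/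
def D4 (N : ℕ) (ω : ℝ → ℝ) (K τ : ℝ) (p : ℝ≥0∞) (s μ : ℝ) : ℝ≥0∞ :=
  ⨅ (g : EuclideanSpace ℝ (Fin N) → ℂ) (_ : MemS ω g) (_ : g ≠ 0),
    D2 ω K p s μ g * ENNReal.ofReal (Real.exp (2 * K * (K ^ 2 * s + μ)))
      * wnorm2 ω (2 * K * (K ^ 2 * s + μ)) 1 (tauWigner (1 - τ) (fun t => g (-t)))

end TimeFreq

end

noncomputable section

namespace TimeFreq

open MeasureTheory Filter Asymptotics
open scoped ENNReal ComplexConjugate FourierTransform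

variable {N : ℕ} {ω : ℝ → ℝ} {K b : ℝ}

/-! For (i), `Wig_τ f(x,ξ)` is bounded twice: by the integral of `|f(x+τt)| |f(x-(1-τ)t)|` over `t`
and, through Parseval, by that of `|f̂(τ⁻¹(ξ+η))| |f̂(-(1-τ)⁻¹η)|` over `η`. In each bound `x`
(respectively `ξ`) is a convex combination of the two arguments, so monotonicity of `ω` carries the
weight inside. The product of the two bounds is an integral over `ℝ^{2N}` of `|Rf|∘T₁ · |Rf|∘T₂`
with `T₁`, `T₂` affine and measure preserving, and Hölder finishes (`wfun_tauWigner_sq_le`).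

For (ii), fix a window `g`. Fourier inversion recovers `f(x) conj(g(x-y))` from the short-time
Fourier transform `V_g f(y,·)`; multiplying by `|g(x-y)|` and integrating over `y` bounds `|f(x)|
‖g‖₂²` by a weighted `‖V_g f‖₁`. The same holds for `f̂` and `ĝ`, because `V_ĝ f̂` is a rotated `V_g
f` up to a phase and a power of `2π`. Hence `|Rf|` is bounded by the square of that `L¹` norm
(`wfun_rihaczek_le_stft`). Hölder trades `L¹` for `L^{2p}` at the cost of `e^{-μω}`, and `|V_g f|²`
is dominated by the convolution of `|Wig_τ f|` with `|Wig_{1-τ} g̃|` (`enorm_stft_sq_le`), to which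
Young's inequality applies. The infimum over `g` is taken last.

Finiteness rests on (γ), which makes `e^{-μω}` decay polynomially, and on (β), which puts the
Gaussian in `𝒮_ω`. -/

/-- The configuration space `ℝ^N`. -/
abbrev E (N : ℕ) := EuclideanSpace ℝ (Fin N)

/-! ### Fourier transform without `2π` in the phase: inversion and Parseval. -/

lemma fourierT_eq_fourier (f : E N → ℂ) (ξ : E N) :
    fourierT f ξ = 𝓕 f ((2 * Real.pi)⁻¹ • ξ) := by
  rw [Real.fourier_eq', fourierT]
  congr 1 with x
  rw [smul_eq_mul, inner_smul_right]
  congr 2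
  push_cast
  have : (Real.pi : ℂ) ≠ 0 := by exact_mod_cast Real.pi_ne_zero
  field_simp

lemma fourier_eq_fourierT (f : E N → ℂ) :
    𝓕 f = fun w => fourierT f ((2 * Real.pi) • w) := by
  ext w
  rw [fourierT_eq_fourier, smul_smul, inv_mul_cancel₀ Real.two_pi_pos.ne', one_smul]

lemma continuous_expI {X : Type*} [TopologicalSpace X] {u : X → ℝ} (hu : Continuous u) :
    Continuous fun x => Complex.exp (-(Complex.I * (u x : ℝ))) := by
  fun_prop

@[simp] lemma norm_expI (r : ℝ) : ‖Complex.exp (-(Complex.I * (r : ℂ)))‖ = 1 := by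
  rw [Complex.norm_exp]; simp

lemma conj_expI (r : ℝ) : conj (Complex.exp (-(Complex.I * (r : ℂ)))) =
    Complex.exp (-(Complex.I * ((-r : ℝ) : ℂ))) := by
  rw [← Complex.exp_conj]; simp

lemma expI_add (r s : ℝ) : Complex.exp (-(Complex.I * ((r + s : ℝ) : ℂ))) =
    Complex.exp (-(Complex.I * (r : ℂ))) * Complex.exp (-(Complex.I * (s : ℂ))) := by
  rw [← Complex.exp_add]; congr 1; push_cast; ring

lemma integrable_expI_mul {f : E N → ℂ} (hf : Integrable f) {u : E N → ℝ} (hu : Continuous u) :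
    Integrable fun x => Complex.exp (-(Complex.I * (u x : ℝ))) * f x := by
  refine hf.bdd_mul (c := 1) (continuous_expI hu).aestronglyMeasurable ?_
  exact .of_forall fun x => by simp

lemma continuous_fourierT {f : E N → ℂ} (hf : Integrable f) : Continuous (fourierT f) := by
  have : Continuous (𝓕 f) := VectorFourier.fourierIntegral_continuous Real.continuous_fourierChar
    (L := innerₗ (E N)) continuous_inner hf
  have h2 : fourierT f = fun ξ => 𝓕 f ((2 * Real.pi)⁻¹ • ξ) := by
    ext ξ; exact fourierT_eq_fourier f ξ
  rw [h2]
  fun_prop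

lemma integrable_fourier_of_fourierT {f : E N → ℂ} (h : Integrable (fourierT f)) :
    Integrable (𝓕 f) := by
  rw [fourier_eq_fourierT]
  exact h.comp_smul Real.two_pi_pos.ne'

/-- Fourier inversion in the normalization of `fourierT`. -/
lemma fourierT_inversion {f : E N → ℂ} (hc : Continuous f) (hf : Integrable f)
    (h : Integrable (fourierT f)) (x : E N) :
    ((2 * Real.pi) ^ N : ℝ) * f x =
      ∫ ξ, Complex.exp (Complex.I * (inner ℝ x ξ : ℝ)) * fourierT f ξ := by
  have h1 := congrFun (hc.fourierInv_fourier_eq hf (integrable_fourier_of_fourierT h)) x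
  rw [Real.fourierInv_eq', fourier_eq_fourierT] at h1
  have h2 := Measure.integral_comp_smul volume
    (fun ξ : E N => Complex.exp (Complex.I * (inner ℝ x ξ : ℝ)) * fourierT f ξ) (2 * Real.pi)
  have h3 : (fun v : E N => Complex.exp (↑(2 * Real.pi * inner ℝ v x) * Complex.I) •
      fourierT f ((2 * Real.pi) • v)) = fun v => Complex.exp (Complex.I *
        (inner ℝ x ((2 * Real.pi) • v) : ℝ)) * fourierT f ((2 * Real.pi) • v) := by
    ext v
    rw [smul_eq_mul, inner_smul_right, real_inner_comm, mul_comm Complex.I]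
  rw [h3, h2, finrank_euclideanSpace_fin, abs_of_pos (by positivity)] at h1
  rw [← h1, Complex.real_smul, ← mul_assoc, ← Complex.ofReal_mul, mul_inv_cancel₀ (by positivity)]
  simp

/-- Integrability of `fourierT f` is not assumed: without it the right side is infinite. This spares
a decay proof for products of `f` with a translated window. -/
lemma enorm_le_lintegral_fourierT {f : E N → ℂ} (hc : Continuous f) (hf : Integrable f) (x : E N) :
    ENNReal.ofReal ((2 * Real.pi) ^ N) * ‖f x‖ₑ ≤ ∫⁻ ξ, ‖fourierT f ξ‖ₑ := by
  by_cases h : Integrable (fourierT f)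
  · have h1 := congrArg enorm (fourierT_inversion hc hf h x)
    rw [enorm_mul] at h1
    have h2 : ‖(((2 * Real.pi) ^ N : ℝ) : ℂ)‖ₑ = ENNReal.ofReal ((2 * Real.pi) ^ N) := by
      rw [← ofReal_norm, Complex.norm_real, Real.norm_of_nonneg (by positivity)]
    rw [h2] at h1
    rw [h1]
    refine (enorm_integral_le_lintegral_enorm _).trans_eq ?_
    congr 1 with ξ
    rw [enorm_mul]
    have : ‖Complex.exp (Complex.I * (inner ℝ x ξ : ℝ))‖ₑ = 1 := by
      rw [← ofReal_norm, Complex.norm_exp]; simp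
    rw [this, one_mul]
  · have : ∫⁻ ξ, ‖fourierT f ξ‖ₑ = ⊤ := by
      by_contra hne
      exact h ⟨(continuous_fourierT hf).aestronglyMeasurable, lt_top_iff_ne_top.2 hne⟩
    rw [this]; exact le_top

/-- Parseval's identity. -/
lemma fourierT_parseval {f k : E N → ℂ} (hc : Continuous f) (hf : Integrable f)
    (h : Integrable (fourierT f)) (hk : Integrable k) :
    ∫ ξ, fourierT f ξ * conj (fourierT k ξ) = ((2 * Real.pi) ^ N : ℝ) * ∫ x, f x * conj (k x) := by
  -- Fubini moves the transform off `k`, so `k` only has to be integrable; inversion is applied to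
  -- `f` alone.
  have h1 : ∫ ξ, conj (𝓕 k ξ) * 𝓕 f ξ = ∫ x, conj (k x) * 𝓕⁻ (𝓕 f) x := by
    have := VectorFourier.integral_sesq_fourierIntegral_eq_neg_flip
      (innerSL ℂ (E := ℂ))
      (L := innerₗ (E N)) Real.continuous_fourierChar continuous_inner hk
      (integrable_fourier_of_fourierT h)
    simp only [innerSL_apply_apply, RCLike.inner_apply', flip_innerₗ] at this
    exact this
  rw [hc.fourierInv_fourier_eq hf (integrable_fourier_of_fourierT h), fourier_eq_fourierT,
    fourier_eq_fourierT] at h1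
  have h2 := Measure.integral_comp_smul volume
    (fun ξ : E N => conj (fourierT k ξ) * fourierT f ξ) (2 * Real.pi)
  simp only [h1] at h2
  rw [finrank_euclideanSpace_fin, abs_of_pos (by positivity)] at h2
  simp_rw [mul_comm (f _), mul_comm (fourierT f _)]
  rw [h2, Complex.real_smul, ← mul_assoc, ← Complex.ofReal_mul, mul_inv_cancel₀ (by positivity)]
  simp

/-! ### The Euclidean norm on phase space. -/

section PhaseNorm

lemma phaseNorm_eq_norm_toLp (z : E N × E N) : phaseNorm z = ‖WithLp.toLp 2 z‖ := by
  rw [WithLp.prod_norm_eq_of_L2]; rfl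

lemma phaseNorm_nonneg (z : E N × E N) : 0 ≤ phaseNorm z := Real.sqrt_nonneg _

lemma continuous_phaseNorm : Continuous (phaseNorm : E N × E N → ℝ) := by
  unfold phaseNorm; fun_prop

lemma norm_fst_le_phaseNorm (z : E N × E N) : ‖z.1‖ ≤ phaseNorm z :=
  Real.le_sqrt_of_sq_le (by nlinarith [sq_nonneg ‖z.2‖])

lemma norm_snd_le_phaseNorm (z : E N × E N) : ‖z.2‖ ≤ phaseNorm z :=
  Real.le_sqrt_of_sq_le (by nlinarith [sq_nonneg ‖z.1‖])

lemma norm_le_phaseNorm (z : E N × E N) : ‖z‖ ≤ phaseNorm z :=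
  max_le (norm_fst_le_phaseNorm z) (norm_snd_le_phaseNorm z)

lemma phaseNorm_le_add (z : E N × E N) : phaseNorm z ≤ ‖z.1‖ + ‖z.2‖ := by
  apply Real.sqrt_le_iff.2
  constructor
  · positivity
  · nlinarith [norm_nonneg z.1, norm_nonneg z.2]

lemma phaseNorm_add_le (z w : E N × E N) : phaseNorm (z + w) ≤ phaseNorm z + phaseNorm w := by
  simp only [phaseNorm_eq_norm_toLp, WithLp.toLp_add]
  exact norm_add_le _ _

end PhaseNorm

/-! ### Inequalities for the weight and integrability of its negative exponentials. -/

namespace IsWeight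

lemma mono (hω : IsWeight ω K b) {s t : ℝ} (hs : 0 ≤ s) (h : s ≤ t) : ω s ≤ ω t :=
  hω.monotoneOn hs (hs.trans h) h

/-- `s + t` is at most twice the larger of the two, so monotonicity and one use of (α) suffice. All
quasi-subadditivity of `ω` comes from here. -/
lemma le_of_le_add (hω : IsWeight ω K b) {r s t : ℝ} (hr : 0 ≤ r) (hs : 0 ≤ s) (ht : 0 ≤ t)
    (h : r ≤ s + t) : ω r ≤ K * (1 + ω s + ω t) := by
  have hK := hω.one_le
  have h1 := hω.nonneg s hs
  have h2 := hω.nonneg t ht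
  rcases le_total s t with hst | hst
  · have := hω.mono hr (show r ≤ 2 * t by linarith)
    have := hω.alpha t ht
    nlinarith
  · have := hω.mono hr (show r ≤ 2 * s by linarith)
    have := hω.alpha s hs
    nlinarith

lemma continuous_comp (hω : IsWeight ω K b) {X : Type*} [TopologicalSpace X] {u : X → ℝ}
    (hu : Continuous u) (h : ∀ x, 0 ≤ u x) : Continuous fun x => ω (u x) :=
  hω.continuousOn.comp_continuous hu h

lemma continuous_norm (hω : IsWeight ω K b) : Continuous fun x : E N => ω ‖x‖ :=
  hω.continuous_comp _root_.continuous_norm fun x => norm_nonneg x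

lemma continuous_phaseNorm (hω : IsWeight ω K b) :
    Continuous fun z : E N × E N => ω (phaseNorm z) :=
  hω.continuous_comp TimeFreq.continuous_phaseNorm phaseNorm_nonneg

lemma norm_le (hω : IsWeight ω K b) (x y : E N) : ω ‖x‖ ≤ K * (1 + ω ‖x - y‖ + ω ‖y‖) :=
  hω.le_of_le_add (norm_nonneg _) (norm_nonneg _) (norm_nonneg _) (by
    simpa using norm_add_le (x - y) y)

lemma phaseNorm_le (hω : IsWeight ω K b) (z w : E N × E N) :
    ω (phaseNorm z) ≤ K * (1 + ω (phaseNorm (z - w)) + ω (phaseNorm w)) :=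
  hω.le_of_le_add (phaseNorm_nonneg _) (phaseNorm_nonneg _) (phaseNorm_nonneg _) (by
    simpa using phaseNorm_add_le (z - w) w)

lemma phaseNorm_le_fst_snd (hω : IsWeight ω K b) (z : E N × E N) :
    ω (phaseNorm z) ≤ K * (1 + ω ‖z.1‖ + ω ‖z.2‖) :=
  hω.le_of_le_add (phaseNorm_nonneg _) (norm_nonneg _) (norm_nonneg _) (phaseNorm_le_add z)

lemma fst_le (hω : IsWeight ω K b) (z : E N × E N) : ω ‖z.1‖ ≤ ω (phaseNorm z) :=
  hω.mono (norm_nonneg _) (norm_fst_le_phaseNorm z)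

lemma snd_le (hω : IsWeight ω K b) (z : E N × E N) : ω ‖z.2‖ ≤ ω (phaseNorm z) :=
  hω.mono (norm_nonneg _) (norm_snd_le_phaseNorm z)

/-- Exponentiating (γ) turns the logarithm into a power. -/
lemma exp_neg_le (hω : IsWeight ω K b) {μ : ℝ} (hμ : 0 ≤ μ) :
    ∃ C, 0 ≤ C ∧ ∀ t, 0 ≤ t → Real.exp (-μ * ω t) ≤ C * (1 + t) ^ (-(b * μ)) := by
  obtain ⟨a, ha⟩ := hω.gamma
  refine ⟨Real.exp (-μ * a), (Real.exp_pos _).le, fun t ht => ?_⟩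
  rw [Real.rpow_def_of_pos (by linarith), ← Real.exp_add]
  apply Real.exp_le_exp.2
  nlinarith [mul_le_mul_of_nonneg_left (ha t ht) hμ]

section Lp

variable {X : Type*} [NormedAddCommGroup X] [NormedSpace ℝ X] [FiniteDimensional ℝ X]
  [MeasurableSpace X] [BorelSpace X] {m : Measure X} [m.IsAddHaarMeasure] {w : X → ℝ}

/-- A power `(1+‖x‖)^{-bμq}` is integrable once `bμq` exceeds the dimension, which is the lower
bound on `μ`. The separate `w` admits the Euclidean weight on a product that carries the maximum
norm. -/
lemma eLpNorm_exp_neg_lt_top (hω : IsWeight ω K b) (hw : ∀ x, ω ‖x‖ ≤ w x) {q : ℝ≥0∞}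
    (hq0 : q ≠ 0) (hqt : q ≠ ⊤) {μ : ℝ} (hμ : (Module.finrank ℝ X : ℝ) / (b * q.toReal) < μ) :
    eLpNorm (fun x => (Real.exp (-μ * w x) : ℂ)) q m < ⊤ := by
  have hb := hω.pos
  have hq := ENNReal.toReal_pos hq0 hqt
  have hμ0 : 0 < μ := lt_of_le_of_lt (by positivity) hμ
  obtain ⟨C, hC0, hC⟩ := hω.exp_neg_le hμ0.le
  rw [eLpNorm_lt_top_iff_lintegral_rpow_enorm_lt_top hq0 hqt]
  have hdim : (Module.finrank ℝ X : ℝ) < b * μ * q.toReal := by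
    rw [div_lt_iff₀ (by positivity)] at hμ
    linarith
  have hfin := finite_integral_one_add_norm (μ := m) hdim
  refine lt_of_le_of_lt (lintegral_mono (g := fun x => ENNReal.ofReal (C ^ q.toReal) *
    ENNReal.ofReal ((1 + ‖x‖) ^ (-(b * μ * q.toReal)))) fun x => ?_) ?_
  · have h1 : Real.exp (-μ * w x) ≤ C * (1 + ‖x‖) ^ (-(b * μ)) := by
      refine le_trans (Real.exp_le_exp.2 ?_) (hC ‖x‖ (norm_nonneg x))
      nlinarith [hw x]
    rw [← ofReal_norm, Complex.norm_real, Real.norm_of_nonneg (Real.exp_pos _).le,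
      ENNReal.ofReal_rpow_of_nonneg (Real.exp_pos _).le hq.le]
    beta_reduce
    rw [← ENNReal.ofReal_mul (by positivity)]
    apply ENNReal.ofReal_le_ofReal
    refine (Real.rpow_le_rpow (Real.exp_pos _).le h1 hq.le).trans_eq ?_
    rw [Real.mul_rpow hC0 (by positivity), ← Real.rpow_mul (by positivity), neg_mul]
  · rw [lintegral_const_mul' _ _ ENNReal.ofReal_ne_top]
    exact ENNReal.mul_lt_top ENNReal.ofReal_lt_top hfin

end Lp

end IsWeight

/-! ### Rapid decay and finiteness of weighted norms. -/

/-- `F` decays faster than every power of `e^{-w}`. -/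
def RapidDecay {X : Type*} (w : X → ℝ) (F : X → ℂ) : Prop :=
  ∀ s : ℝ, ∃ C : ℝ, ∀ x, Real.exp (s * w x) * ‖F x‖ ≤ C

lemma RapidDecay.le_exp {X : Type*} {w : X → ℝ} {F : X → ℂ} (h : RapidDecay w F) (s : ℝ) :
    ∃ C : ℝ, 0 ≤ C ∧ ∀ x, ‖F x‖ ≤ C * Real.exp (-s * w x) := by
  obtain ⟨C, hC⟩ := h s
  refine ⟨max C 0, le_max_right _ _, fun x => ?_⟩
  have h1 := (hC x).trans (le_max_left C 0)
  calc ‖F x‖ = Real.exp (s * w x) * ‖F x‖ * Real.exp (-s * w x) := by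
        rw [mul_right_comm, ← Real.exp_add]; simp
    _ ≤ _ := by gcongr

section Lp

variable {X : Type*} [NormedAddCommGroup X] [NormedSpace ℝ X] [FiniteDimensional ℝ X]
  [MeasurableSpace X] [BorelSpace X] {m : Measure X} [m.IsAddHaarMeasure] {w : X → ℝ}

lemma RapidDecay.eLpNorm_lt_top (hω : IsWeight ω K b) (hw : ∀ x, ω ‖x‖ ≤ w x)
    {F : X → ℂ} (hF : RapidDecay w F) (s : ℝ) (p : ℝ≥0∞) :
    eLpNorm (fun x => (Real.exp (s * w x) : ℂ) * F x) p m < ⊤ := by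
  have key : ∀ μ : ℝ, ∃ C : ℝ, 0 ≤ C ∧
      ∀ x, ‖(Real.exp (s * w x) : ℂ) * F x‖ ≤ C * ‖(Real.exp (-μ * w x) : ℂ)‖ := by
    intro μ
    -- Decay at rate `s + μ` absorbs `e^{sw}` and leaves `e^{-μw}` to integrate.
    obtain ⟨C, hC0, hC⟩ := hF.le_exp (s + μ)
    refine ⟨C, hC0, fun x => ?_⟩
    rw [norm_mul, Complex.norm_real, Real.norm_of_nonneg (Real.exp_pos _).le, Complex.norm_real,
      Real.norm_of_nonneg (Real.exp_pos _).le]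
    calc _ ≤ Real.exp (s * w x) * (C * Real.exp (-(s + μ) * w x)) := by gcongr; exact hC x
      _ = C * (Real.exp (s * w x) * Real.exp (-(s + μ) * w x)) := by ring
      _ = _ := by rw [← Real.exp_add]; ring_nf
  rcases eq_or_ne p 0 with rfl | hp0
  · simp
  rcases eq_or_ne p ⊤ with rfl | hpt
  · obtain ⟨C, hC0, hC⟩ := key 0
    rw [eLpNorm_exponent_top]
    refine lt_of_le_of_lt (eLpNormEssSup_le_of_ae_bound (C := C) (.of_forall fun x => ?_))
      ENNReal.ofReal_lt_top
    simpa using hC x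
  · obtain ⟨C, hC0, hC⟩ := key ((Module.finrank ℝ X : ℝ) / (b * p.toReal) + 1)
    refine lt_of_le_of_lt (eLpNorm_le_mul_eLpNorm_of_ae_le_mul (.of_forall hC) p) ?_
    exact ENNReal.mul_lt_top ENNReal.ofReal_lt_top
      (hω.eLpNorm_exp_neg_lt_top hw hp0 hpt (lt_add_one _))

lemma RapidDecay.memLp (hω : IsWeight ω K b) (hw : ∀ x, ω ‖x‖ ≤ w x)
    {F : X → ℂ} (hF : RapidDecay w F) (hm : AEStronglyMeasurable F m) (p : ℝ≥0∞) :
    MemLp F p m := by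
  refine ⟨hm, ?_⟩
  simpa using hF.eLpNorm_lt_top (m := m) hω hw 0 p

end Lp

section MemS

lemma RapidDecay.of_pos {X : Type*} {w : X → ℝ} (hw : ∀ x, 0 ≤ w x) {F : X → ℂ}
    (h : ∀ s : ℝ, 0 < s → ∃ C : ℝ, ∀ x, Real.exp (s * w x) * ‖F x‖ ≤ C) : RapidDecay w F := by
  intro s
  obtain ⟨C, hC⟩ := h (max s 1) (by positivity)
  refine ⟨C, fun x => le_trans ?_ (hC x)⟩
  gcongr
  · exact hw x
  · exact le_max_left _ _

lemma MemS.rapidDecay (hω : IsWeight ω K b) {f : E N → ℂ} (hf : MemS ω f) :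
    RapidDecay (fun x : E N => ω ‖x‖) f :=
  .of_pos (fun x => hω.nonneg _ (norm_nonneg x)) fun s hs => hf.bound s hs []

lemma MemS.rapidDecay_fourierT (hω : IsWeight ω K b) {f : E N → ℂ} (hf : MemS ω f) :
    RapidDecay (fun x : E N => ω ‖x‖) (fourierT f) :=
  .of_pos (fun x => hω.nonneg _ (norm_nonneg x)) fun s hs => hf.bound_fourier s hs []

lemma MemS.continuous {f : E N → ℂ} (hf : MemS ω f) : Continuous f := hf.smooth.continuous

lemma MemS.integrable_fourierT (hω : IsWeight ω K b) {f : E N → ℂ} (hf : MemS ω f) :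
    Integrable (fourierT f) :=
  memLp_one_iff_integrable.1 ((hf.rapidDecay_fourierT hω).memLp hω (fun _ => le_rfl)
    hf.smooth_fourier.continuous.aestronglyMeasurable 1)

lemma wnorm2_lt_top (hω : IsWeight ω K b) {F : E N × E N → ℂ}
    (hF : RapidDecay (fun z => ω (phaseNorm z)) F) (s : ℝ) (p : ℝ≥0∞) :
    wnorm2 ω s p F < ⊤ :=
  hF.eLpNorm_lt_top (m := (volume : Measure (E N)).prod volume) hω
    (fun z => hω.mono (norm_nonneg z) (norm_le_phaseNorm z)) s p

lemma rapidDecay_rihaczek (hω : IsWeight ω K b) {f : E N → ℂ} (hf : MemS ω f) :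
    RapidDecay (fun z => ω (phaseNorm z)) (rihaczek f) := by
  refine .of_pos (fun z => hω.nonneg _ (phaseNorm_nonneg z)) fun s hs => ?_
  obtain ⟨C, hC⟩ := hf.rapidDecay hω (s * K)
  obtain ⟨D, hD⟩ := hf.rapidDecay_fourierT hω (s * K)
  refine ⟨Real.exp (s * K) * C * D, fun z => ?_⟩
  have h1 : ‖rihaczek f z‖ = ‖f z.1‖ * ‖fourierT f z.2‖ := by
    rw [rihaczek, norm_mul, norm_mul, norm_expI, one_mul, RCLike.norm_conj]
  have h2 : Real.exp (s * ω (phaseNorm z)) ≤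
      Real.exp (s * K) * Real.exp (s * K * ω ‖z.1‖) * Real.exp (s * K * ω ‖z.2‖) := by
    rw [← Real.exp_add, ← Real.exp_add]
    apply Real.exp_le_exp.2
    nlinarith [mul_le_mul_of_nonneg_left (hω.phaseNorm_le_fst_snd z) hs.le]
  calc _ ≤ Real.exp (s * K) * Real.exp (s * K * ω ‖z.1‖) * Real.exp (s * K * ω ‖z.2‖) *
        (‖f z.1‖ * ‖fourierT f z.2‖) := by rw [h1]; gcongr
    _ = Real.exp (s * K) * (Real.exp (s * K * ω ‖z.1‖) * ‖f z.1‖) *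
        (Real.exp (s * K * ω ‖z.2‖) * ‖fourierT f z.2‖) := by ring
    _ ≤ _ := by
      have := hC z.1
      have := hD z.2
      have hC0 : 0 ≤ C := le_trans (by positivity) (hC z.1)
      gcongr

end MemS

/-! ### The Wigner transform bounded by the Rihaczek form. -/

/-- The Jacobians `|c|^N` and `|c|^{-N}` of the two components cancel. -/
lemma measurePreserving_scale {c : ℝ} (hc : c ≠ 0) (x y : E N) :
    MeasurePreserving (fun z : E N × E N => (x + c • z.1, y + c⁻¹ • z.2)) volume volume := by
  have hc' : c⁻¹ ≠ 0 := inv_ne_zero hc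
  have h1 : MeasurePreserving (fun z : E N × E N => (c • z.1, c⁻¹ • z.2)) volume volume := by
    refine ⟨by fun_prop, ?_⟩
    change Measure.map (Prod.map (c • ·) (c⁻¹ • ·)) (volume.prod volume) = _
    rw [← Measure.map_prod_map _ _ (by fun_prop) (by fun_prop), Measure.map_addHaar_smul _ hc,
      Measure.map_addHaar_smul _ hc', Measure.prod_smul_left, Measure.prod_smul_right, smul_smul,
      ← ENNReal.ofReal_mul (abs_nonneg _), ← abs_mul, inv_pow, inv_inv,
      inv_mul_cancel₀ (pow_ne_zero _ hc)]
    simp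
    rfl
  exact ((measurePreserving_add_left volume x).prod (measurePreserving_add_left volume y)).comp h1

/-- The Fourier transform of a modulated, dilated and translated function. -/
lemma fourierT_modulate_dilate (f : E N → ℂ) {c : ℝ} (hc : c ≠ 0) (x ζ η : E N) :
    fourierT (fun t => Complex.exp (-(Complex.I * (inner ℝ t ζ : ℝ))) * f (x + c • t)) η =
      (|(c ^ N)⁻¹| : ℝ) * (Complex.exp (-(Complex.I * (-inner ℝ x (c⁻¹ • (ζ + η)) : ℝ))) *
        fourierT f (c⁻¹ • (ζ + η))) := by
  -- Substituting `u = x + ct` turns the phase `t·(ζ+η)` into `(u-x)·θ`.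
  set θ := c⁻¹ • (ζ + η) with hθ
  have hζ : ζ + η = c • θ := by rw [hθ, smul_smul, mul_inv_cancel₀ hc, one_smul]
  clear_value θ
  let G : E N → ℂ := fun u => Complex.exp (-(Complex.I * (inner ℝ (u - x) θ : ℝ))) * f u
  have h1 : (fun t : E N => Complex.exp (-(Complex.I * (inner ℝ t η : ℝ))) *
      (Complex.exp (-(Complex.I * (inner ℝ t ζ : ℝ))) * f (x + c • t))) =
      fun t => G (x + c • t) := by
    ext t
    have : inner ℝ (x + c • t - x) θ = inner ℝ t η + inner ℝ t ζ := by
      rw [add_sub_cancel_left, real_inner_smul_left, ← inner_add_right, add_comm η, hζ,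
        real_inner_smul_right]
    simp only [G, this, expI_add, mul_assoc]
  have h2 := Measure.integral_comp_smul (volume : Measure (E N)) (fun u => G (x + u)) c
  rw [integral_add_left_eq_self, finrank_euclideanSpace_fin] at h2
  rw [fourierT, h1, h2, Complex.real_smul]
  congr 1
  rw [fourierT, ← integral_const_mul]
  congr 1 with u
  simp only [G]
  rw [← mul_assoc, ← expI_add, inner_sub_left, neg_add_eq_sub]

lemma integrable_comp_affine {f : E N → ℂ} (hf : Integrable f) {c : ℝ} (hc : c ≠ 0) (x : E N) :
    Integrable fun t => f (x + c • t) :=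
  (hf.comp_add_left x).comp_smul hc

lemma integrable_fourierT_modulate_dilate {f : E N → ℂ} (hf : Integrable (fourierT f)) {c : ℝ}
    (hc : c ≠ 0) (x ζ : E N) :
    Integrable (fourierT
      (fun t => Complex.exp (-(Complex.I * (inner ℝ t ζ : ℝ))) * f (x + c • t))) := by
  have h : fourierT (fun t => Complex.exp (-(Complex.I * (inner ℝ t ζ : ℝ))) * f (x + c • t)) =
      fun η => (|(c ^ N)⁻¹| : ℝ) * (Complex.exp (-(Complex.I * (-inner ℝ x (c⁻¹ • (ζ + η)) : ℝ))) *
        fourierT f (c⁻¹ • (ζ + η))) := by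
    ext η; exact fourierT_modulate_dilate f hc x ζ η
  rw [h]
  refine Integrable.const_mul (integrable_expI_mul ?_ (by fun_prop)) _
  have := integrable_comp_affine hf (inv_ne_zero hc) (c⁻¹ • ζ)
  simpa only [smul_add] using this

lemma enorm_expI (r : ℝ) : ‖Complex.exp (-(Complex.I * (r : ℂ)))‖ₑ = 1 := by
  rw [← ofReal_norm, norm_expI, ENNReal.ofReal_one]

lemma enorm_conj (z : ℂ) : ‖conj z‖ₑ = ‖z‖ₑ := by
  rw [← ofReal_norm, RCLike.norm_conj, ofReal_norm]

lemma enorm_tauWigner_le (τ : ℝ) (f : E N → ℂ) (z : E N × E N) :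
    ‖tauWigner τ f z‖ₑ ≤ ∫⁻ t, ‖f (z.1 + τ • t)‖ₑ * ‖f (z.1 + (-(1 - τ)) • t)‖ₑ := by
  refine (enorm_integral_le_lintegral_enorm _).trans_eq ?_
  congr 1 with t
  rw [enorm_mul, enorm_mul, enorm_expI, one_mul, enorm_conj, neg_smul, sub_eq_add_neg]

/-- Parseval in `t`, applied to the two dilated copies of `f`; their Jacobians `τ^{-N}` and
`(1-τ)^{-N}` produce `(τ-τ²)^N`. -/
lemma enorm_tauWigner_le_fourierT {τ : ℝ} (hτ0 : 0 < τ) (hτ1 : τ < 1) {f : E N → ℂ}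
    (hc : Continuous f) (hf : Integrable f) (hf' : Integrable (fourierT f)) (z : E N × E N) :
    ENNReal.ofReal ((2 * Real.pi) ^ N * (τ - τ ^ 2) ^ N) * ‖tauWigner τ f z‖ₑ ≤
      ∫⁻ η, ‖fourierT f (τ⁻¹ • z.2 + τ⁻¹ • η)‖ₑ *
        ‖fourierT f (0 + (-(1 - τ))⁻¹ • η)‖ₑ := by
  have hτ : τ ≠ 0 := hτ0.ne'
  have hσ : -(1 - τ) ≠ 0 := by linarith
  have hττ : 0 < τ - τ ^ 2 := by nlinarith
  set u : E N → ℂ := fun t => Complex.exp (-(Complex.I * (inner ℝ t z.2 : ℝ))) * f (z.1 + τ • t)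
  -- The trivial modulation by `0` gives `k` the form required by `fourierT_modulate_dilate`.
  set k : E N → ℂ := fun t => Complex.exp (-(Complex.I * (inner ℝ t (0 : E N) : ℝ))) *
    f (z.1 + (-(1 - τ)) • t)
  have hW : tauWigner τ f z = ∫ t, u t * conj (k t) := by
    rw [tauWigner]
    congr 1 with t
    simp only [u, k, inner_zero_right, Complex.ofReal_zero, mul_zero, neg_zero, Complex.exp_zero,
      one_mul, neg_smul, ← sub_eq_add_neg]
  have hP := fourierT_parseval (f := u) (k := k) (by fun_prop)
    (integrable_expI_mul (integrable_comp_affine hf hτ _) (by fun_prop))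
    (integrable_fourierT_modulate_dilate hf' hτ _ _)
    (integrable_expI_mul (integrable_comp_affine hf hσ _) (by fun_prop))
  rw [← hW] at hP
  have hP' := congrArg enorm hP
  rw [enorm_mul, ← ofReal_norm ((_ : ℝ) : ℂ), Complex.norm_real,
    Real.norm_of_nonneg (by positivity)] at hP'
  have hle : ENNReal.ofReal ((2 * Real.pi) ^ N) * ‖tauWigner τ f z‖ₑ ≤
      ENNReal.ofReal (((τ - τ ^ 2) ^ N)⁻¹) *
      ∫⁻ η, ‖fourierT f (τ⁻¹ • z.2 + τ⁻¹ • η)‖ₑ * ‖fourierT f (0 + (-(1 - τ))⁻¹ • η)‖ₑ := by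
    rw [← hP', ← lintegral_const_mul' _ _ ENNReal.ofReal_ne_top]
    refine (enorm_integral_le_lintegral_enorm _).trans_eq ?_
    congr 1 with η
    rw [enorm_mul, enorm_conj, fourierT_modulate_dilate f hτ, fourierT_modulate_dilate f hσ]
    simp only [enorm_mul, enorm_expI, one_mul]
    rw [← ofReal_norm ((_ : ℝ) : ℂ), ← ofReal_norm ((_ : ℝ) : ℂ), Complex.norm_real,
      Complex.norm_real, norm_abs_eq_norm, norm_abs_eq_norm]
    rw [mul_mul_mul_comm, ← ENNReal.ofReal_mul (norm_nonneg _), ← norm_mul, smul_add, zero_add,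
      zero_add, ← mul_inv, ← mul_pow, norm_inv, norm_pow]
    congr 5
    rw [Real.norm_eq_abs, show τ * -(1 - τ) = -(τ - τ ^ 2) by ring, abs_neg, abs_of_pos hττ]
  rw [mul_comm ((2 * Real.pi) ^ N), ENNReal.ofReal_mul (by positivity), mul_assoc]
  refine (mul_le_mul_right hle _).trans_eq ?_
  rw [← mul_assoc, ← ENNReal.ofReal_mul (by positivity), mul_inv_cancel₀ (by positivity),
    ENNReal.ofReal_one, one_mul]

lemma IsWeight.le_add_of_le_max (hω : IsWeight ω K b) {x u v : E N} (h : ‖x‖ ≤ max ‖u‖ ‖v‖) :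
    ω ‖x‖ ≤ ω ‖u‖ + ω ‖v‖ := by
  have h1 := hω.nonneg _ (norm_nonneg u)
  have h2 := hω.nonneg _ (norm_nonneg v)
  rcases le_max_iff.1 h with h | h
  · linarith [hω.mono (norm_nonneg x) h]
  · linarith [hω.mono (norm_nonneg x) h]

lemma norm_convex_comb_le {τ : ℝ} (hτ0 : 0 < τ) (hτ1 : τ < 1) {x u v : E N}
    (h : x = τ • u + (1 - τ) • v) : ‖x‖ ≤ max ‖u‖ ‖v‖ := by
  have h1 : ‖x‖ ≤ τ * ‖u‖ + (1 - τ) * ‖v‖ := by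
    rw [h]
    refine (norm_add_le _ _).trans_eq ?_
    rw [norm_smul, norm_smul, Real.norm_of_nonneg hτ0.le, Real.norm_of_nonneg (by linarith)]
  have h2 := le_max_left ‖u‖ ‖v‖
  have h3 := le_max_right ‖u‖ ‖v‖
  nlinarith

lemma norm_le_max_translate {τ : ℝ} (hτ0 : 0 < τ) (hτ1 : τ < 1) (x t : E N) :
    ‖x‖ ≤ max ‖x + τ • t‖ ‖x + (-(1 - τ)) • t‖ := by
  -- Here `x = τ(x-(1-τ)t) + (1-τ)(x+τt)`: the coefficient `τ` belongs to the second argument.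
  rw [max_comm]
  apply norm_convex_comb_le hτ0 hτ1
  module

lemma norm_le_max_dilate {τ : ℝ} (hτ0 : 0 < τ) (hτ1 : τ < 1) (ξ η : E N) :
    ‖ξ‖ ≤ max ‖τ⁻¹ • ξ + τ⁻¹ • η‖ ‖0 + (-(1 - τ))⁻¹ • η‖ := by
  apply norm_convex_comb_le hτ0 hτ1
  have h1 : τ ≠ 0 := hτ0.ne'
  have h2 : 1 - τ ≠ 0 := by linarith
  rw [← smul_add, smul_smul, mul_inv_cancel₀ h1, zero_add, smul_smul, inv_neg, mul_neg,
    mul_inv_cancel₀ h2]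
  module

/-- The weight `e^{sω}` times `‖f‖`, with values in `[0,∞]`. -/
def wfun {X : Type*} (w : X → ℝ) (s : ℝ) (f : X → ℂ) (x : X) : ℝ≥0∞ :=
  ENNReal.ofReal (Real.exp (s * w x)) * ‖f x‖ₑ

lemma enorm_exp_mul (r : ℝ) (z : ℂ) :
    ‖(Real.exp r : ℂ) * z‖ₑ = ENNReal.ofReal (Real.exp r) * ‖z‖ₑ := by
  rw [enorm_mul, ← ofReal_norm ((_ : ℝ) : ℂ), Complex.norm_real,
    Real.norm_of_nonneg (Real.exp_pos _).le]

lemma ofReal_exp_le_mul {r s t : ℝ} (h : r ≤ s + t) : ENNReal.ofReal (Real.exp r) ≤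
    ENNReal.ofReal (Real.exp s) * ENNReal.ofReal (Real.exp t) := by
  rw [← ENNReal.ofReal_mul (Real.exp_pos _).le, ← Real.exp_add]
  exact ENNReal.ofReal_le_ofReal (Real.exp_le_exp.2 h)

/-- The bound is kept at every point, not only almost everywhere, so that it also yields the rapid
decay of `tauWigner τ f`. -/
lemma wfun_tauWigner_sq_le (hω : IsWeight ω K b) {p : ℝ≥0∞} (hp : 1 ≤ p) {τ : ℝ} (hτ0 : 0 < τ)
    (hτ1 : τ < 1) {s : ℝ} (hs : 0 ≤ s) {f : E N → ℂ} (hf : MemS ω f) (z : E N × E N) :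
    wfun (fun z => ω (phaseNorm z)) s (tauWigner τ f) z ^ 2 ≤ ENNReal.ofReal (D3 N K τ s)
      * wnorm2 ω (4 * K ^ 2 * s) p (rihaczek f)
      * wnorm2 ω (4 * K ^ 2 * s) p.conjExponent (rihaczek f) := by
  have hK := hω.one_le
  have hττ : 0 < τ - τ ^ 2 := by nlinarith
  have hcf := hf.continuous
  have hcf' := hf.smooth_fourier.continuous
  have hcw := hω.continuous_norm (N := N)
  set w : E N → ℝ := fun x => ω ‖x‖
  -- Squaring `e^{sω(z)}` and using `ω(z) ≤ K(1+ω(x)+ω(ξ))` puts the exponent `2sK` on each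
  -- variable.
  set a := 2 * s * K with ha
  have ha0 : 0 ≤ a := by positivity
  set F := wfun w a f with hF
  set G := wfun w a (fourierT f) with hG
  set W := tauWigner τ f z
  have hFm : Measurable F := by unfold F wfun; fun_prop
  have hGm : Measurable G := by unfold G wfun; fun_prop
  have hA : ENNReal.ofReal (Real.exp (a * w z.1)) * ‖W‖ₑ ≤
      ∫⁻ t, F (z.1 + τ • t) * F (z.1 + (-(1 - τ)) • t) := by
    refine (mul_le_mul_right (enorm_tauWigner_le τ f z) _).trans ?_
    rw [← lintegral_const_mul' _ _ ENNReal.ofReal_ne_top]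
    refine lintegral_mono fun t => ?_
    rw [hF, wfun, wfun, mul_mul_mul_comm]
    gcongr
    apply ofReal_exp_le_mul
    rw [← mul_add]
    gcongr
    exact hω.le_add_of_le_max (norm_le_max_translate hτ0 hτ1 _ _)
  have hB : ENNReal.ofReal (Real.exp (a * w z.2)) *
      (ENNReal.ofReal ((2 * Real.pi) ^ N * (τ - τ ^ 2) ^ N) * ‖W‖ₑ) ≤
      ∫⁻ η, G (τ⁻¹ • z.2 + τ⁻¹ • η) * G (0 + (-(1 - τ))⁻¹ • η) := by
    refine (mul_le_mul_right (enorm_tauWigner_le_fourierT hτ0 hτ1 hcf hf.integrable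
      (hf.integrable_fourierT hω) z) _).trans ?_
    rw [← lintegral_const_mul' _ _ ENNReal.ofReal_ne_top]
    refine lintegral_mono fun η => ?_
    rw [hG, wfun, wfun, mul_mul_mul_comm]
    gcongr
    apply ofReal_exp_le_mul
    rw [← mul_add]
    gcongr
    exact hω.le_add_of_le_max (norm_le_max_dilate hτ0 hτ1 _ _)
  let Φ : E N × E N → ℂ := fun z =>
    (Real.exp (4 * K ^ 2 * s * ω (phaseNorm z)) : ℂ) * rihaczek f z
  have hcΦ : Continuous Φ := by
    refine (Complex.continuous_ofReal.comp (Real.continuous_exp.comp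
      (hω.continuous_phaseNorm.const_mul _))).mul (Continuous.mul (by fun_prop) ?_)
    exact Complex.continuous_conj.comp (by fun_prop)
  have hΦ : ∀ y, F y.1 * G y.2 ≤ ‖Φ y‖ₑ := by
    intro y
    have h1 : ‖rihaczek f y‖ₑ = ‖f y.1‖ₑ * ‖fourierT f y.2‖ₑ := by
      rw [rihaczek, enorm_mul, enorm_mul, enorm_expI, one_mul, enorm_conj]
    rw [enorm_exp_mul, h1, hF, hG, wfun, wfun, mul_mul_mul_comm]
    gcongr
    rw [← ENNReal.ofReal_mul (Real.exp_pos _).le, ← Real.exp_add]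
    apply ENNReal.ofReal_le_ofReal
    apply Real.exp_le_exp.2
    have h2 := hω.fst_le y
    have h3 := hω.snd_le y
    have h4 : 0 ≤ ω (phaseNorm y) := hω.nonneg _ (phaseNorm_nonneg y)
    calc a * w y.1 + a * w y.2 ≤ a * ω (phaseNorm y) + a * ω (phaseNorm y) := by gcongr
      _ = 4 * K * (s * ω (phaseNorm y)) := by rw [ha]; ring
      -- The argument gives `4K`; it is enlarged to `4K²` by `K ≥ 1`.
      _ ≤ 4 * K ^ 2 * (s * ω (phaseNorm y)) := by gcongr; nlinarith
      _ = _ := by ring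
  set T₁ : E N × E N → E N × E N := fun y => (z.1 + τ • y.1, τ⁻¹ • z.2 + τ⁻¹ • y.2)
  set T₂ : E N × E N → E N × E N :=
    fun y => (z.1 + (-(1 - τ)) • y.1, 0 + (-(1 - τ))⁻¹ • y.2)
  have hT₁ : MeasurePreserving T₁ volume volume := measurePreserving_scale hτ0.ne' _ _
  have hT₂ : MeasurePreserving T₂ volume volume :=
    measurePreserving_scale (by linarith) _ _
  have hprod : (∫⁻ t, F (z.1 + τ • t) * F (z.1 + (-(1 - τ)) • t)) *
      (∫⁻ η, G (τ⁻¹ • z.2 + τ⁻¹ • η) * G (0 + (-(1 - τ))⁻¹ • η)) ≤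
      wnorm2 ω (4 * K ^ 2 * s) p (rihaczek f) *
        wnorm2 ω (4 * K ^ 2 * s) p.conjExponent (rihaczek f) := by
    rw [← lintegral_prod_mul (by fun_prop) (by fun_prop)]
    have := ENNReal.HolderConjugate.conjExponent hp
    have hH := eLpNorm_smul_le_mul_eLpNorm (μ := (volume : Measure (E N × E N))) (p := p)
      (q := p.conjExponent) (r := 1) (f := Φ ∘ T₂) (φ := Φ ∘ T₁)
      (hcΦ.aestronglyMeasurable.comp_measurePreserving hT₂)
      (hcΦ.aestronglyMeasurable.comp_measurePreserving hT₁)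
    rw [eLpNorm_comp_measurePreserving hcΦ.aestronglyMeasurable hT₁,
      eLpNorm_comp_measurePreserving hcΦ.aestronglyMeasurable hT₂,
      eLpNorm_one_eq_lintegral_enorm] at hH
    refine le_trans (lintegral_mono fun y => ?_) hH
    rw [Pi.smul_apply', smul_eq_mul, enorm_mul, mul_mul_mul_comm]
    exact mul_le_mul' (hΦ (T₁ y)) (hΦ (T₂ y))
  set P := wnorm2 ω (4 * K ^ 2 * s) p (rihaczek f) *
    wnorm2 ω (4 * K ^ 2 * s) p.conjExponent (rihaczek f)
  have hE : ENNReal.ofReal (Real.exp (s * ω (phaseNorm z))) ^ 2 ≤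
      ENNReal.ofReal (Real.exp (K * (1 + 2 * K) * s)) *
      (ENNReal.ofReal (Real.exp (a * w z.1)) * ENNReal.ofReal (Real.exp (a * w z.2))) := by
    rw [← ENNReal.ofReal_pow (Real.exp_pos _).le, ← ENNReal.ofReal_mul (Real.exp_pos _).le,
      ← Real.exp_add, ← Real.exp_nat_mul]
    apply ofReal_exp_le_mul
    have h1 := mul_le_mul_of_nonneg_left (hω.phaseNorm_le_fst_snd z) hs
    -- Only `e^{2sK}` is needed; the exponent in `D3` is larger since `K ≥ 1`.
    have h2 : 2 * (s * K) ≤ K * (1 + 2 * K) * s := by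
      nlinarith [mul_nonneg (mul_nonneg hs (by linarith : 0 ≤ K)) (by linarith : 0 ≤ 2 * K - 1)]
    push_cast
    simp only [w, ha]
    linarith
  have hc0 : 0 < (2 * Real.pi) ^ N * (τ - τ ^ 2) ^ N := by positivity
  have hD : ENNReal.ofReal (D3 N K τ s) * ENNReal.ofReal ((2 * Real.pi) ^ N * (τ - τ ^ 2) ^ N) =
      ENNReal.ofReal (Real.exp (K * (1 + 2 * K) * s)) := by
    rw [← ENNReal.ofReal_mul' hc0.le, D3, div_mul_cancel₀ _ hc0.ne']
  rw [mul_assoc, wfun, mul_pow]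
  calc _ ≤ (ENNReal.ofReal (D3 N K τ s) *
        ENNReal.ofReal ((2 * Real.pi) ^ N * (τ - τ ^ 2) ^ N) *
      (ENNReal.ofReal (Real.exp (a * w z.1)) * ENNReal.ofReal (Real.exp (a * w z.2)))) *
        ‖W‖ₑ ^ 2 := by rw [hD]; gcongr
    _ = ENNReal.ofReal (D3 N K τ s) * ((ENNReal.ofReal (Real.exp (a * w z.1)) * ‖W‖ₑ) *
        (ENNReal.ofReal (Real.exp (a * w z.2)) *
      (ENNReal.ofReal ((2 * Real.pi) ^ N * (τ - τ ^ 2) ^ N) * ‖W‖ₑ))) := by ring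
    _ ≤ _ := by
      exact mul_le_mul_right ((mul_le_mul' hA hB).trans hprod) _

lemma wnorm2_top_sq_le {F : E N × E N → ℂ} {s : ℝ} {M : ℝ≥0∞}
    (h : ∀ z, wfun (fun z => ω (phaseNorm z)) s F z ^ 2 ≤ M) : wnorm2 ω s ⊤ F ^ 2 ≤ M := by
  have h1 : wnorm2 ω s ⊤ F ≤ M ^ (2 : ℝ)⁻¹ := by
    rw [wnorm2, eLpNorm_exponent_top]
    refine eLpNormEssSup_le_of_ae_enorm_bound (.of_forall fun z => ?_)
    rw [enorm_exp_mul, ENNReal.le_rpow_inv_iff (by norm_num)]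
    exact_mod_cast h z
  rw [ENNReal.le_rpow_inv_iff (by norm_num)] at h1
  exact_mod_cast h1

lemma rapidDecay_tauWigner (hω : IsWeight ω K b) {τ : ℝ} (hτ0 : 0 < τ) (hτ1 : τ < 1)
    {f : E N → ℂ} (hf : MemS ω f) :
    RapidDecay (fun z => ω (phaseNorm z)) (tauWigner τ f) := by
  refine .of_pos (fun z => hω.nonneg _ (phaseNorm_nonneg z)) fun s hs => ?_
  -- The choice `p = 1` is arbitrary: every weighted norm of `rihaczek f` is finite.
  have h := wfun_tauWigner_sq_le hω le_rfl hτ0 hτ1 hs.le hf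
  set M := ENNReal.ofReal (D3 N K τ s) * wnorm2 ω (4 * K ^ 2 * s) 1 (rihaczek f)
      * wnorm2 ω (4 * K ^ 2 * s) (ENNReal.conjExponent 1) (rihaczek f)
  have hM : M < ⊤ := ENNReal.mul_lt_top (ENNReal.mul_lt_top ENNReal.ofReal_lt_top
    (wnorm2_lt_top hω (rapidDecay_rihaczek hω hf) _ _))
    (wnorm2_lt_top hω (rapidDecay_rihaczek hω hf) _ _)
  refine ⟨Real.sqrt M.toReal, fun z => Real.le_sqrt_of_sq_le ?_⟩
  have h1 := ENNReal.toReal_mono hM.ne (h z)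
  rwa [wfun, ENNReal.toReal_pow, ENNReal.toReal_mul, ENNReal.toReal_ofReal (Real.exp_pos _).le,
    toReal_enorm] at h1

theorem tauWigner_bound (hω : IsWeight ω K b) {p : ℝ≥0∞} (hp : 1 ≤ p) {τ : ℝ} (hτ0 : 0 < τ)
    (hτ1 : τ < 1) {s : ℝ} (hs : 0 ≤ s) {f : E N → ℂ} (hf : MemS ω f) :
    wnorm2 ω s ⊤ (tauWigner τ f) ^ 2 ≤ ENNReal.ofReal (D3 N K τ s)
      * wnorm2 ω (4 * K ^ 2 * s) p (rihaczek f)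
      * wnorm2 ω (4 * K ^ 2 * s) p.conjExponent (rihaczek f) :=
  wnorm2_top_sq_le (wfun_tauWigner_sq_le hω hp hτ0 hτ1 hs hf)

/-! ### The short-time Fourier transform controls the Rihaczek form. -/

/-- The short-time Fourier transform `V_g f(x,ξ) = ∫ e^{-i t·ξ} f(t) conj(g(t - x)) dt`. -/
def stft (g f : E N → ℂ) (z : E N × E N) : ℂ :=
  fourierT (fun t => f t * conj (g (t - z.1))) z.2

lemma measurable_stft {g f : E N → ℂ} (hg : Continuous g) (hf : Continuous f) :
    Measurable (stft g f) := by
  have hc : Continuous fun p : (E N × E N) × E N =>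
      Complex.exp (-(Complex.I * (inner ℝ p.2 p.1.2 : ℝ))) * (f p.2 * conj (g (p.2 - p.1.1))) :=
    (continuous_expI (by fun_prop)).mul
      ((by fun_prop : Continuous fun p : (E N × E N) × E N => f p.2).mul
        (Complex.continuous_conj.comp (by fun_prop)))
  exact (hc.stronglyMeasurable.integral_prod_right' (ν := volume)).measurable

lemma measurable_tauWigner (τ : ℝ) {f : E N → ℂ} (hf : Continuous f) :
    Measurable (tauWigner τ f) := by
  have hc : Continuous fun p : (E N × E N) × E N =>
      Complex.exp (-(Complex.I * (inner ℝ p.2 p.1.2 : ℝ))) * f (p.1.1 + τ • p.2) *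
        conj (f (p.1.1 - (1 - τ) • p.2)) :=
    ((continuous_expI (by fun_prop)).mul
      (by fun_prop : Continuous fun p : (E N × E N) × E N => f (p.1.1 + τ • p.2))).mul
        (Complex.continuous_conj.comp (by fun_prop))
  exact (hc.stronglyMeasurable.integral_prod_right' (ν := volume)).measurable

lemma integrable_mul_conj {f g : E N → ℂ} (hf : Integrable f) (hg : Continuous g)
    {C : ℝ} (hC : ∀ x, ‖g x‖ ≤ C) : Integrable fun t => f t * conj (g t) :=
  hf.mul_bdd (c := C) (Complex.continuous_conj.comp hg).aestronglyMeasurable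
    (.of_forall fun x => by simpa using hC x)

/-- The pointwise bound for `f` in terms of its short-time Fourier transform. -/
lemma enorm_mul_window_le {f g : E N → ℂ} (hcf : Continuous f) (hf : Integrable f)
    (hcg : Continuous g) {C : ℝ} (hC : ∀ x, ‖g x‖ ≤ C) (x y : E N) :
    ENNReal.ofReal ((2 * Real.pi) ^ N) * (‖f x‖ₑ * ‖g (x - y)‖ₑ) ≤ ∫⁻ η, ‖stft g f (y, η)‖ₑ := by
  have h := enorm_le_lintegral_fourierT (f := fun t => f t * conj (g (t - y)))
    (hcf.mul (Complex.continuous_conj.comp (by fun_prop)))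
    (integrable_mul_conj (g := fun t => g (t - y)) hf (by fun_prop) fun t => hC (t - y)) x
  rwa [enorm_mul, enorm_conj] at h

lemma measurable_wfun {X : Type*} [TopologicalSpace X] [MeasurableSpace X] [BorelSpace X]
    {w : X → ℝ} (hw : Continuous w) (s : ℝ) {F : X → ℂ} (hF : Measurable F) :
    Measurable (wfun w s F) := by
  unfold wfun
  have := hw.measurable
  fun_prop

lemma ae_wfun_le_wnorm (s : ℝ) (g : E N → ℂ) :
    ∀ᵐ x : E N, wfun (fun x => ω ‖x‖) s g x ≤ wnorm ω s ⊤ g := by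
  rw [wnorm, eLpNorm_exponent_top]
  filter_upwards [enorm_ae_le_eLpNormEssSup
    (fun x : E N => (Real.exp (s * ω ‖x‖) : ℂ) * g x) volume] with x hx
  rwa [enorm_exp_mul] at hx

/-- Of the two factors `|g(x-y)|`, one is paired with `f` by inversion; the other takes the weight
`e^{K²sω(x-y)}` and is replaced by its supremum. -/
lemma wfun_mul_lintegral_sq_le (hω : IsWeight ω K b) {s : ℝ} (hs : 0 ≤ s) {f g : E N → ℂ}
    (hcf : Continuous f) (hf : Integrable f) (hcg : Continuous g) {C : ℝ} (hC : ∀ x, ‖g x‖ ≤ C)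
    (x : E N) :
    wfun (fun x => ω ‖x‖) (s * K) f x * (∫⁻ t, ‖g t‖ₑ ^ 2) * ENNReal.ofReal ((2 * Real.pi) ^ N) ≤
      ENNReal.ofReal (Real.exp (K ^ 2 * s)) * wnorm ω (K ^ 2 * s) ⊤ g *
        ∫⁻ z, wfun (fun z => ω (phaseNorm z)) (K ^ 2 * s) (stft g f) z := by
  have hK := hω.one_le
  have hm : Measurable (wfun (fun z : E N × E N => ω (phaseNorm z)) (K ^ 2 * s) (stft g f)) :=
    measurable_wfun hω.continuous_phaseNorm _ (measurable_stft hcg hcf)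
  have hshift : ∫⁻ t, ‖g t‖ₑ ^ 2 = ∫⁻ y, ‖g (x - y)‖ₑ ^ 2 :=
    (lintegral_sub_left_eq_self (fun t => ‖g t‖ₑ ^ 2) x).symm
  rw [hshift, mul_right_comm,
    ← lintegral_const_mul _ (by have := hcg.measurable; fun_prop)]
  rw [Measure.volume_eq_prod, lintegral_prod _ hm.aemeasurable,
    ← lintegral_const_mul _ hm.lintegral_prod_right']
  have hae : ∀ᵐ y : E N, wfun (fun x => ω ‖x‖) (K ^ 2 * s) g (x - y) ≤ wnorm ω (K ^ 2 * s) ⊤ g :=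
    (Measure.measurePreserving_sub_left volume x).quasiMeasurePreserving.ae (ae_wfun_le_wnorm _ g)
  refine lintegral_mono_ae (hae.mono fun y hy => ?_)
  have hE : ENNReal.ofReal (Real.exp (s * K * ω ‖x‖)) ≤ ENNReal.ofReal (Real.exp (K ^ 2 * s)) *
      (ENNReal.ofReal (Real.exp (K ^ 2 * s * ω ‖x - y‖)) *
        ENNReal.ofReal (Real.exp (K ^ 2 * s * ω ‖y‖))) := by
    rw [← ENNReal.ofReal_mul (Real.exp_pos _).le, ← Real.exp_add]
    apply ofReal_exp_le_mul
    have := mul_le_mul_of_nonneg_left (hω.norm_le x y) (by positivity : 0 ≤ s * K)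
    linarith
  have hη : ENNReal.ofReal (Real.exp (K ^ 2 * s * ω ‖y‖)) * ∫⁻ η, ‖stft g f (y, η)‖ₑ ≤
      ∫⁻ η, wfun (fun z => ω (phaseNorm z)) (K ^ 2 * s) (stft g f) (y, η) := by
    rw [← lintegral_const_mul' _ _ ENNReal.ofReal_ne_top]
    refine lintegral_mono fun η => ?_
    rw [wfun]
    gcongr
    exact hω.fst_le (y, η)
  calc wfun (fun x => ω ‖x‖) (s * K) f x * ENNReal.ofReal ((2 * Real.pi) ^ N) * ‖g (x - y)‖ₑ ^ 2
      = ENNReal.ofReal (Real.exp (s * K * ω ‖x‖)) * (‖g (x - y)‖ₑ *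
        (ENNReal.ofReal ((2 * Real.pi) ^ N) * (‖f x‖ₑ * ‖g (x - y)‖ₑ))) := by rw [wfun]; ring
    _ ≤ (ENNReal.ofReal (Real.exp (K ^ 2 * s)) *
      (ENNReal.ofReal (Real.exp (K ^ 2 * s * ω ‖x - y‖)) *
        ENNReal.ofReal (Real.exp (K ^ 2 * s * ω ‖y‖)))) * (‖g (x - y)‖ₑ *
        ∫⁻ η, ‖stft g f (y, η)‖ₑ) := by
      gcongr
      exact enorm_mul_window_le hcf hf hcg hC x y
    _ = ENNReal.ofReal (Real.exp (K ^ 2 * s)) * wfun (fun x => ω ‖x‖) (K ^ 2 * s) g (x - y) *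
        (ENNReal.ofReal (Real.exp (K ^ 2 * s * ω ‖y‖)) * ∫⁻ η, ‖stft g f (y, η)‖ₑ) := by
      rw [wfun]; ring
    _ ≤ _ := by gcongr

/-- The fundamental identity of time-frequency analysis, in absolute values. -/
lemma enorm_stft_fourierT {f g : E N → ℂ} (hcf : Continuous f) (hf : Integrable f)
    (hf' : Integrable (fourierT f)) (hg : Integrable g) (y η : E N) :
    ‖stft (fourierT g) (fourierT f) (η, -y)‖ₑ =
      ENNReal.ofReal ((2 * Real.pi) ^ N) * ‖stft g f (y, η)‖ₑ := by
  -- `k(t) = e^{it·η} g(t-y)`, so that pairing `f` with `k` gives `V_g f(y,η)`.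
  let k : E N → ℂ := fun t => Complex.exp (-(Complex.I * (inner ℝ t (-η) : ℝ))) *
    g (-y + (1 : ℝ) • t)
  have hk : Integrable k := integrable_expI_mul (integrable_comp_affine hg one_ne_zero _)
    (by fun_prop)
  have hP := fourierT_parseval hcf hf hf' hk
  have h1 : ∫ x, f x * conj (k x) = stft g f (y, η) := by
    rw [stft, fourierT]
    congr 1 with t
    simp only [k, map_mul, conj_expI, inner_neg_right, neg_neg, one_smul, neg_add_eq_sub]
    ring
  have h2 : ∫ ξ, fourierT f ξ * conj (fourierT k ξ) =
      Complex.exp (-(Complex.I * (inner ℝ y η : ℝ))) *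
      stft (fourierT g) (fourierT f) (η, -y) := by
    rw [stft, fourierT, ← integral_const_mul]
    congr 1 with ζ
    rw [fourierT_modulate_dilate g one_ne_zero]
    simp only [one_pow, inv_one, abs_one, Complex.ofReal_one, one_mul, one_smul, neg_add_eq_sub,
      map_mul, conj_expI]
    have : inner ℝ (-y) (ζ - η) = -inner ℝ ζ y + inner ℝ y η := by
      rw [inner_neg_left, inner_sub_right, real_inner_comm]; ring
    rw [← mul_assoc, ← mul_assoc (Complex.exp _), ← expI_add, neg_neg, this, inner_neg_right]
    ring_nf
  rw [h1, h2] at hP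
  have hP' := congrArg enorm hP
  rwa [enorm_mul, enorm_mul, enorm_expI, one_mul, ← ofReal_norm ((_ : ℝ) : ℂ), Complex.norm_real,
    Real.norm_of_nonneg (by positivity)] at hP'

lemma measurePreserving_rotate :
    MeasurePreserving (fun z : E N × E N => (z.2, -z.1)) volume volume := by
  have h1 : MeasurePreserving (fun z : E N × E N => (-z.1, z.2)) volume volume :=
    (Measure.measurePreserving_neg (volume : Measure (E N))).prod (.id volume)
  exact (Measure.measurePreserving_swap (μ := (volume : Measure (E N))) (ν := volume)).comp h1

lemma lintegral_wfun_stft_fourierT (hω : IsWeight ω K b) {f g : E N → ℂ} (hcf : Continuous f)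
    (hf : Integrable f) (hf' : Integrable (fourierT f)) (hg : Integrable g) (s : ℝ) :
    ∫⁻ z, wfun (fun z => ω (phaseNorm z)) s (stft (fourierT g) (fourierT f)) z =
      ENNReal.ofReal ((2 * Real.pi) ^ N) *
        ∫⁻ z, wfun (fun z => ω (phaseNorm z)) s (stft g f) z := by
  rw [← lintegral_const_mul' _ _ ENNReal.ofReal_ne_top,
    ← measurePreserving_rotate.lintegral_comp (measurable_wfun hω.continuous_phaseNorm _
      (measurable_stft (continuous_fourierT hg) (continuous_fourierT hf)))]
  congr 1 with z
  have : phaseNorm ((z.2, -z.1) : E N × E N) = phaseNorm z := by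
    simp [phaseNorm, add_comm]
  rw [wfun, enorm_stft_fourierT hcf hf hf' hg, this, wfun]
  ring

/-- Plancherel's identity. -/
lemma lintegral_fourierT_sq {g : E N → ℂ} (hcg : Continuous g) (hg : Integrable g)
    (hg' : Integrable (fourierT g)) (h2 : MemLp g 2) (h2' : MemLp (fourierT g) 2) :
    ∫⁻ ξ, ‖fourierT g ξ‖ₑ ^ 2 = ENNReal.ofReal ((2 * Real.pi) ^ N) * ∫⁻ x, ‖g x‖ₑ ^ 2 := by
  have key : ∀ h : E N → ℂ, MemLp h 2 →
      ∫⁻ x, ‖h x‖ₑ ^ 2 = ENNReal.ofReal (∫ x, ‖h x‖ ^ 2) := by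
    intro h hh
    rw [ofReal_integral_eq_lintegral_ofReal ((memLp_two_iff_integrable_sq_norm hh.1).1 hh)
      (.of_forall fun x => by positivity)]
    congr 1 with x
    rw [ENNReal.ofReal_pow (norm_nonneg _), ofReal_norm]
  have hP := fourierT_parseval hcg hg hg' hg
  simp_rw [Complex.mul_conj'] at hP
  norm_cast at hP
  rw [key _ h2, key _ h2', ← ENNReal.ofReal_mul (by positivity)]
  congr 1

lemma enorm_rihaczek (f : E N → ℂ) (z : E N × E N) :
    ‖rihaczek f z‖ₑ = ‖f z.1‖ₑ * ‖fourierT f z.2‖ₑ := by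
  rw [rihaczek, enorm_mul, enorm_mul, enorm_expI, one_mul, enorm_conj]

lemma MemS.exists_norm_le (hω : IsWeight ω K b) {f : E N → ℂ} (hf : MemS ω f) :
    ∃ C, ∀ x, ‖f x‖ ≤ C := by
  obtain ⟨C, hC⟩ := hf.rapidDecay hω 0
  exact ⟨C, fun x => by simpa using hC x⟩

lemma MemS.exists_norm_fourierT_le (hω : IsWeight ω K b) {f : E N → ℂ} (hf : MemS ω f) :
    ∃ C, ∀ x, ‖fourierT f x‖ ≤ C := by
  obtain ⟨C, hC⟩ := hf.rapidDecay_fourierT hω 0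
  exact ⟨C, fun x => by simpa using hC x⟩

lemma wfun_rihaczek_le_stft (hω : IsWeight ω K b) {s : ℝ} (hs : 0 ≤ s) {f g : E N → ℂ}
    (hf : MemS ω f) (hg : MemS ω g) (z : E N × E N) :
    wfun (fun z => ω (phaseNorm z)) s (rihaczek f) z * (ENNReal.ofReal ((2 * Real.pi) ^ (2 * N)) *
      (∫⁻ t, ‖g t‖ₑ ^ 2) ^ 2) ≤
      ENNReal.ofReal (Real.exp (K * (1 + 2 * K) * s)) * wnorm ω (K ^ 2 * s) ⊤ g *
        wnorm ω (K ^ 2 * s) ⊤ (fourierT g) *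
        (∫⁻ z, wfun (fun z => ω (phaseNorm z)) (K ^ 2 * s) (stft g f) z) ^ 2 := by
  obtain ⟨C, hC⟩ := hg.exists_norm_le hω
  obtain ⟨C', hC'⟩ := hg.exists_norm_fourierT_le hω
  have hcf := hf.continuous
  have hcg := hg.continuous
  have hcf' := hf.smooth_fourier.continuous
  have hcg' := hg.smooth_fourier.continuous
  set c := ENNReal.ofReal ((2 * Real.pi) ^ N) with hc
  set n := ∫⁻ t, ‖g t‖ₑ ^ 2
  set J := ∫⁻ z, wfun (fun z => ω (phaseNorm z)) (K ^ 2 * s) (stft g f) z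
  set e := ENNReal.ofReal (Real.exp (K ^ 2 * s))
  have hc0 : c ≠ 0 := by simp only [hc, ne_eq, ENNReal.ofReal_eq_zero, not_le]; positivity
  have hct : c ≠ ⊤ := ENNReal.ofReal_ne_top
  have h1 := wfun_mul_lintegral_sq_le hω hs hcf hf.integrable hcg hC z.1
  have h2 := wfun_mul_lintegral_sq_le hω hs hcf' (hf.integrable_fourierT hω) hcg' hC' z.2
  rw [lintegral_wfun_stft_fourierT hω hcf hf.integrable (hf.integrable_fourierT hω) hg.integrable,
    lintegral_fourierT_sq hcg hg.integrable (hg.integrable_fourierT hω)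
      ((hg.rapidDecay hω).memLp hω (fun _ => le_rfl) hcg.aestronglyMeasurable 2)
      ((hg.rapidDecay_fourierT hω).memLp hω (fun _ => le_rfl) hcg'.aestronglyMeasurable 2)] at h2
  -- The factor `(2π)^N` from Plancherel for `g` cancels the one from rotating `V_g f`.
  have h2' : wfun (fun x => ω ‖x‖) (s * K) (fourierT f) z.2 * n * c ≤
      e * wnorm ω (K ^ 2 * s) ⊤ (fourierT g) * J := by
    rw [← ENNReal.mul_le_mul_iff_right hc0 hct]
    calc _ = wfun (fun x => ω ‖x‖) (s * K) (fourierT f) z.2 * (c * n) * c := by ring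
      _ ≤ _ := h2
      _ = _ := by ring
  have hE : ENNReal.ofReal (Real.exp (s * ω (phaseNorm z))) ≤ ENNReal.ofReal (Real.exp (s * K)) *
      (ENNReal.ofReal (Real.exp (s * K * ω ‖z.1‖)) *
        ENNReal.ofReal (Real.exp (s * K * ω ‖z.2‖))) := by
    rw [← ENNReal.ofReal_mul (Real.exp_pos _).le, ← Real.exp_add]
    apply ofReal_exp_le_mul
    have := mul_le_mul_of_nonneg_left (hω.phaseNorm_le_fst_snd z) hs
    linarith
  have hcc : ENNReal.ofReal ((2 * Real.pi) ^ (2 * N)) = c * c := by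
    rw [hc, ← ENNReal.ofReal_mul (by positivity), ← pow_add, two_mul N]
  -- One factor `e^{sK}` comes from splitting `ω(z)`, two factors `e^{K²s}` from the bounds for `f`
  -- and `f̂`.
  have hee : ENNReal.ofReal (Real.exp (K * (1 + 2 * K) * s)) =
      ENNReal.ofReal (Real.exp (s * K)) * (e * e) := by
    rw [← ENNReal.ofReal_mul (Real.exp_pos _).le, ← ENNReal.ofReal_mul (Real.exp_pos _).le,
      ← Real.exp_add, ← Real.exp_add]
    ring_nf
  rw [hcc, hee]
  calc _ ≤ ENNReal.ofReal (Real.exp (s * K)) * (ENNReal.ofReal (Real.exp (s * K * ω ‖z.1‖)) *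
        ENNReal.ofReal (Real.exp (s * K * ω ‖z.2‖))) * (‖f z.1‖ₑ * ‖fourierT f z.2‖ₑ) *
        (c * c * n ^ 2) := by rw [wfun, enorm_rihaczek]; gcongr
    _ = ENNReal.ofReal (Real.exp (s * K)) * ((wfun (fun x => ω ‖x‖) (s * K) f z.1 * n * c) *
        (wfun (fun x => ω ‖x‖) (s * K) (fourierT f) z.2 * n * c)) := by rw [wfun, wfun]; ring
    _ ≤ ENNReal.ofReal (Real.exp (s * K)) * ((e * wnorm ω (K ^ 2 * s) ⊤ g * J) *
        (e * wnorm ω (K ^ 2 * s) ⊤ (fourierT g) * J)) := by gcongr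
    _ = _ := by ring

/-! ### Young's inequality for nonnegative functions. -/

section Young

variable {X : Type*} [AddCommGroup X] [MeasurableSpace X] [MeasurableAdd₂ X] [MeasurableNeg X]
  {m : Measure X} [SFinite m] [m.IsAddLeftInvariant] [m.IsNegInvariant]

/-- Hölder with `B` split as `B^{1/r} B^{1/q}`. -/
lemma rpow_lintegral_mul_le {Y : Type*} [MeasurableSpace Y] {ν : Measure Y} {A B : Y → ℝ≥0∞}
    (hA : Measurable A) (hB : Measurable B) {r : ℝ} (hr : 1 ≤ r) :
    (∫⁻ y, A y * B y ∂ν) ^ r ≤ (∫⁻ y, A y ^ r * B y ∂ν) * (∫⁻ y, B y ∂ν) ^ (r - 1) := by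
  rcases hr.eq_or_lt with rfl | hr
  · simp
  have hr0 : 0 < r := by linarith
  have hq := Real.HolderConjugate.conjExponent hr
  set q := r.conjExponent
  have hsum : r⁻¹ + q⁻¹ = 1 := hq.inv_add_inv_eq_one
  have hH := ENNReal.lintegral_mul_le_Lp_mul_Lq ν hq
    (f := fun y => A y * B y ^ r⁻¹) (g := fun y => B y ^ q⁻¹) (by fun_prop) (by fun_prop)
  have h1 : ∀ y, A y * B y = ((fun y => A y * B y ^ r⁻¹) * fun y => B y ^ q⁻¹) y := by
    intro y
    simp only [Pi.mul_apply]
    rw [mul_assoc, ← ENNReal.rpow_add_of_nonneg _ _ (inv_nonneg.2 hr0.le)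
      (inv_nonneg.2 hq.symm.nonneg), hsum, ENNReal.rpow_one]
  have h2 : ∀ y, (A y * B y ^ r⁻¹) ^ r = A y ^ r * B y := by
    intro y
    rw [ENNReal.mul_rpow_of_nonneg _ _ hr0.le, ← ENNReal.rpow_mul, inv_mul_cancel₀ hr0.ne',
      ENNReal.rpow_one]
  have h3 : ∀ y, (B y ^ q⁻¹) ^ q = B y := by
    intro y
    rw [← ENNReal.rpow_mul, inv_mul_cancel₀ hq.symm.ne_zero, ENNReal.rpow_one]
  simp_rw [h2, h3, ← h1] at hH
  refine (ENNReal.rpow_le_rpow hH hr0.le).trans_eq ?_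
  rw [ENNReal.mul_rpow_of_nonneg _ _ hr0.le, ← ENNReal.rpow_mul, ← ENNReal.rpow_mul,
    one_div_mul_cancel hr0.ne', ENNReal.rpow_one]
  congr 2
  have : q⁻¹ = 1 - r⁻¹ := by linarith
  rw [one_div, this, sub_mul, inv_mul_cancel₀ hr0.ne', one_mul]

/-- Young's inequality `‖A * B‖_p ≤ ‖A‖_p ‖B‖₁`. -/
theorem eLpNorm_lconv_le {A B : X → ℝ≥0∞} (hA : Measurable A) (hB : Measurable B) {p : ℝ≥0∞}
    (hp : 1 ≤ p) :
    eLpNorm (fun z => ∫⁻ w, A w * B (z - w) ∂m) p m ≤ eLpNorm A p m * ∫⁻ w, B w ∂m := by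
  rcases eq_or_ne p ⊤ with rfl | hpt
  · rw [eLpNorm_exponent_top, eLpNorm_exponent_top]
    refine eLpNormEssSup_le_of_ae_enorm_bound (.of_forall fun z => ?_)
    rw [enorm_eq_self, ← lintegral_sub_left_eq_self B z, ← lintegral_const_mul _ (by fun_prop)]
    refine lintegral_mono_ae ?_
    filter_upwards [enorm_ae_le_eLpNormEssSup A m] with w hw
    rw [enorm_eq_self] at hw
    gcongr
  have hp0 : p ≠ 0 := (zero_lt_one.trans_le hp).ne'
  set r := p.toReal with hr
  have hr1 : 1 ≤ r := by
    rw [hr, ← ENNReal.toReal_one]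
    exact ENNReal.toReal_mono hpt hp
  have hr0 : 0 < r := by linarith
  rw [eLpNorm_eq_lintegral_rpow_enorm_toReal hp0 hpt,
    eLpNorm_eq_lintegral_rpow_enorm_toReal hp0 hpt, ← hr]
  simp only [enorm_eq_self]
  set I := ∫⁻ w, B w ∂m
  -- Hölder gives `I^{r-1}`; Tonelli in `z` supplies the remaining factor `I`.
  have h1 : ∫⁻ z, (∫⁻ w, A w * B (z - w) ∂m) ^ r ∂m ≤ (∫⁻ w, A w ^ r ∂m) * I ^ r := by
    calc _ ≤ ∫⁻ z, (∫⁻ w, A w ^ r * B (z - w) ∂m) * I ^ (r - 1) ∂m := by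
          refine lintegral_mono fun z => ?_
          have := rpow_lintegral_mul_le (ν := m) hA (B := fun w => B (z - w)) (by fun_prop) hr1
          rwa [lintegral_sub_left_eq_self B z] at this
      _ = (∫⁻ z, ∫⁻ w, A w ^ r * B (z - w) ∂m ∂m) * I ^ (r - 1) := by
          rw [lintegral_mul_const]
          exact Measurable.lintegral_prod_right' (f := fun q : X × X => A q.2 ^ r * B (q.1 - q.2))
            (by fun_prop)
      _ = (∫⁻ w, A w ^ r ∂m) * I * I ^ (r - 1) := by
          rw [lintegral_lintegral_swap (by fun_prop)]
          congr 1
          rw [← lintegral_mul_const _ (by fun_prop)]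
          refine lintegral_congr fun w => ?_
          rw [lintegral_const_mul _ (f := fun x => B (x - w)) (by fun_prop),
            lintegral_sub_right_eq_self B]
      _ = _ := by
          rw [mul_assoc]
          congr 1
          nth_rewrite 1 [← ENNReal.rpow_one I]
          rw [← ENNReal.rpow_add_of_nonneg _ _ zero_le_one (by linarith)]
          ring_nf
  refine (ENNReal.rpow_le_rpow h1 (by positivity)).trans_eq ?_
  rw [ENNReal.mul_rpow_of_nonneg _ _ (by positivity), ← ENNReal.rpow_mul,
    mul_one_div_cancel hr0.ne', ENNReal.rpow_one]

end Young

/-! ### The spectrogram and the convolution of Wigner transforms. -/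

/-- A shear followed by `(u,t) ↦ (u,u-t)`, each preserving the measure fibrewise. -/
lemma measurePreserving_wigner (τ : ℝ) :
    MeasurePreserving (fun z : E N × E N => (z.1 + τ • z.2, z.1 - (1 - τ) • z.2))
      volume volume := by
  have h1 : MeasurePreserving (fun z : E N × E N => (z.1 + τ • z.2, z.2)) volume volume := by
    have h := (MeasurePreserving.id (volume : Measure (E N))).skew_product
      (μc := (volume : Measure (E N))) (μd := volume) (g := fun y x => x + τ • y) (by fun_prop)
      (.of_forall fun y => map_add_right_eq_self volume (τ • y))
    have hs := Measure.measurePreserving_swap (μ := (volume : Measure (E N)))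
      (ν := (volume : Measure (E N)))
    exact (hs.comp h).comp hs
  have h2 : MeasurePreserving (fun z : E N × E N => (z.1, z.1 - z.2)) volume volume :=
    (MeasurePreserving.id (volume : Measure (E N))).skew_product
      (μc := (volume : Measure (E N))) (μd := volume) (g := fun y x => y - x) (by fun_prop)
      (.of_forall fun y => (Measure.measurePreserving_sub_left volume y).map_eq)
  convert! h2.comp h1 using 2 with z
  simp only [Function.comp_apply, Prod.mk.injEq, true_and]
  module

/-- Supplies the integrable transform that Parseval demands in `enorm_stft_sq_le`. -/
lemma integrable_tauWigner_section (hω : IsWeight ω K b) {τ : ℝ} (hτ0 : 0 < τ) (hτ1 : τ < 1)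
    {f : E N → ℂ} (hf : MemS ω f) (y : E N) : Integrable fun η => tauWigner τ f (y, η) := by
  have hd : RapidDecay (fun η : E N => ω ‖η‖) fun η => tauWigner τ f (y, η) := by
    refine .of_pos (fun η => hω.nonneg _ (norm_nonneg η)) fun s hs => ?_
    obtain ⟨C, hC⟩ := rapidDecay_tauWigner hω hτ0 hτ1 hf s
    refine ⟨C, fun η => le_trans ?_ (hC (y, η))⟩
    gcongr
    exact hω.snd_le (y, η)
  exact memLp_one_iff_integrable.1 (hd.memLp hω (fun _ => le_rfl)
    ((measurable_tauWigner τ hf.continuous).comp measurable_prodMk_left).aestronglyMeasurable 1)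

/-- The spectrogram is dominated by the convolution of two `τ`-Wigner transforms. -/
lemma enorm_stft_sq_le (hω : IsWeight ω K b) {τ : ℝ} (hτ0 : 0 < τ) (hτ1 : τ < 1)
    {f g : E N → ℂ} (hf : MemS ω f) (hcg : Continuous g) (hg : Integrable g) {C : ℝ}
    (hC : ∀ x, ‖g x‖ ≤ C) (z : E N × E N) :
    ENNReal.ofReal ((2 * Real.pi) ^ N) * ‖stft g f z‖ₑ ^ 2 ≤
      ∫⁻ w, ‖tauWigner τ f w‖ₑ * ‖tauWigner (1 - τ) (fun t => g (-t)) (z - w)‖ₑ := by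
  obtain ⟨x, ξ⟩ := z
  have hcf := hf.continuous
  obtain ⟨D, hD⟩ := hf.exists_norm_le hω
  have hσ : -(1 - τ) ≠ 0 := by linarith
  have hcconj := Complex.continuous_conj
  let u : E N → ℂ := fun t => Complex.exp (-(Complex.I * (inner ℝ t ξ : ℝ))) *
    (f t * conj (g (t - x)))
  have hu : Integrable u := integrable_expI_mul
    (integrable_mul_conj (g := fun t => g (t - x)) hf.integrable (by fun_prop) fun t => hC _)
    (by fun_prop)
  have hu' : Integrable fun t => conj (u t) := by
    refine hu.congr' ?_ ?_
    · exact hcconj.comp_aestronglyMeasurable hu.1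
    · exact .of_forall fun t => by simp
  have hV : stft g f (x, ξ) = ∫ t, u t := rfl
  let S : E N × E N → E N × E N := fun z => (z.1 + τ • z.2, z.1 - (1 - τ) • z.2)
  have hS : MeasurePreserving S volume volume := measurePreserving_wigner τ
  have hint : Integrable (fun q : E N × E N => u q.1 * conj (u q.2))
    (volume.prod volume) := hu.mul_prod hu'
  have hV2 : stft g f (x, ξ) * conj (stft g f (x, ξ)) =
      ∫ y, ∫ t, u (y + τ • t) * conj (u (y - (1 - τ) • t)) := by
    rw [hV, ← integral_conj, ← integral_prod_mul]
    have h1 := integral_map (μ := (volume : Measure (E N × E N))) hS.measurable.aemeasurable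
      (f := fun q : E N × E N => u q.1 * conj (u q.2)) (by rw [hS.map_eq]; exact hint.1)
    rw [hS.map_eq] at h1
    refine h1.trans ?_
    exact integral_prod _ (hS.integrable_comp_of_integrable hint)
  have hsq : ‖stft g f (x, ξ)‖ₑ ^ 2 = ‖stft g f (x, ξ) * conj (stft g f (x, ξ))‖ₑ := by
    rw [enorm_mul, enorm_conj, sq]
  have hinner : ∀ y : E N, ENNReal.ofReal ((2 * Real.pi) ^ N) *
      ‖∫ t, u (y + τ • t) * conj (u (y - (1 - τ) • t))‖ₑ ≤
      ∫⁻ η, ‖tauWigner τ f (y, η)‖ₑ *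
        ‖tauWigner (1 - τ) (fun t => g (-t)) ((x, ξ) - (y, η))‖ₑ := by
    intro y
    -- The product of the two values of `u` is regrouped: `φ` collects `f`, `k` collects `g`. Since
    -- `(y+τt)-(y-(1-τ)t) = t`, the two phases combine to `e^{-it·ξ}`, which goes to `k`.
    let φ : E N → ℂ := fun t => f (y + τ • t) * conj (f (y - (1 - τ) • t))
    let k : E N → ℂ := fun t => Complex.exp (-(Complex.I * (inner ℝ t (-ξ) : ℝ))) *
      (g (y - x + τ • t) * conj (g (y - x - (1 - τ) • t)))
    have hφ : Integrable φ := integrable_mul_conj (g := fun t => f (y - (1 - τ) • t))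
      (integrable_comp_affine hf.integrable hτ0.ne' y) (by fun_prop) fun t => hD _
    have hk : Integrable k := integrable_expI_mul (integrable_mul_conj
      (g := fun t => g (y - x - (1 - τ) • t))
      (integrable_comp_affine hg hτ0.ne' (y - x)) (by fun_prop) fun t => hC _) (by fun_prop)
    have hφT : ∀ η, fourierT φ η = tauWigner τ f (y, η) := by
      intro η
      rw [fourierT, tauWigner]
      simp only [φ, mul_assoc]
    have hφi : Integrable (fourierT φ) := by
      rw [show fourierT φ = fun η => tauWigner τ f (y, η) from funext hφT]
      exact integrable_tauWigner_section hω hτ0 hτ1 hf y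
    have hkT : ∀ η, conj (fourierT k η) =
        tauWigner (1 - τ) (fun t => g (-t)) ((x, ξ) - (y, η)) := by
      intro η
      rw [fourierT, tauWigner, ← integral_conj]
      congr 1 with t
      have e1 : -(x - y + (1 - τ) • t) = y - x - (1 - τ) • t := by module
      have e2 : -(x - y - (1 - (1 - τ)) • t) = y - x + τ • t := by module
      have e3 : inner ℝ t (ξ - η) = -inner ℝ t η + -inner ℝ t (-ξ) := by
        rw [inner_sub_right, inner_neg_right]; ring
      simp only [k, Prod.mk_sub_mk, e1, e2, e3, expI_add, map_mul, conj_expI,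
        RingHomCompTriple.comp_apply, RingHom.id_apply]
      ring
    have hcφ : Continuous φ := (by fun_prop : Continuous fun t => f (y + τ • t)).mul
      (hcconj.comp (by fun_prop))
    have hP := fourierT_parseval hcφ hφ hφi hk
    have hφk : ∀ t, φ t * conj (k t) = u (y + τ • t) * conj (u (y - (1 - τ) • t)) := by
      intro t
      have e1 : y - x + τ • t = y + τ • t - x := by module
      have e2 : y - x - (1 - τ) • t = y - (1 - τ) • t - x := by module
      have e3 : inner ℝ t ξ = inner ℝ (y + τ • t) ξ + -inner ℝ (y - (1 - τ) • t) ξ := by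
        rw [inner_add_left, inner_sub_left, real_inner_smul_left, real_inner_smul_left]; ring
      simp only [φ, k, u, e1, e2, map_mul, conj_expI, inner_neg_right, neg_neg, e3, expI_add,
        RingHomCompTriple.comp_apply, RingHom.id_apply]
      ring
    simp_rw [hφk, hφT, hkT] at hP
    have hP' := congrArg enorm hP
    rw [enorm_mul, ← ofReal_norm ((_ : ℝ) : ℂ), Complex.norm_real,
      Real.norm_of_nonneg (by positivity)] at hP'
    rw [← hP']
    refine (enorm_integral_le_lintegral_enorm _).trans_eq ?_
    simp_rw [enorm_mul]
  calc _ ≤ ENNReal.ofReal ((2 * Real.pi) ^ N) *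
        ∫⁻ y, ‖∫ t, u (y + τ • t) * conj (u (y - (1 - τ) • t))‖ₑ := by
        rw [hsq, hV2]
        gcongr
        exact enorm_integral_le_lintegral_enorm _
    _ = ∫⁻ y, ENNReal.ofReal ((2 * Real.pi) ^ N) *
        ‖∫ t, u (y + τ • t) * conj (u (y - (1 - τ) • t))‖ₑ :=
        (lintegral_const_mul' _ _ ENNReal.ofReal_ne_top).symm
    _ ≤ ∫⁻ y, ∫⁻ η, ‖tauWigner τ f (y, η)‖ₑ *
        ‖tauWigner (1 - τ) (fun t => g (-t)) ((x, ξ) - (y, η))‖ₑ := lintegral_mono hinner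
    _ = _ := by
        have hm1 := measurable_tauWigner τ hcf
        have hm2 : Measurable (tauWigner (1 - τ) (fun t => g (-t))) :=
          measurable_tauWigner (1 - τ) (by fun_prop)
        rw [Measure.volume_eq_prod, lintegral_prod]
        fun_prop

/-- The weighted `L^{2p}`-norm of the short-time Fourier transform. -/
lemma eLpNorm_stft_sq_le (hω : IsWeight ω K b) {p : ℝ≥0∞} (hp : 1 ≤ p) {τ : ℝ} (hτ0 : 0 < τ)
    (hτ1 : τ < 1) {ν : ℝ} (hν : 0 ≤ ν) {f g : E N → ℂ} (hf : MemS ω f) (hg : MemS ω g) :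
    eLpNorm (wfun (fun z => ω (phaseNorm z)) ν (stft g f)) (2 * p) volume ^ 2 ≤
      wnorm2 ω (2 * K * ν) p (tauWigner τ f) * (ENNReal.ofReal (Real.exp (2 * K * ν)) *
        wnorm2 ω (2 * K * ν) 1 (tauWigner (1 - τ) (fun t => g (-t)))) := by
  obtain ⟨C, hC⟩ := hg.exists_norm_le hω
  have hcg := hg.continuous
  set W : E N × E N → ℝ := fun z => ω (phaseNorm z) with hW
  have hcW : Continuous W := hω.continuous_phaseNorm
  set A := wfun W (2 * K * ν) (tauWigner τ f) with hA
  set B := wfun W (2 * K * ν) (tauWigner (1 - τ) (fun t => g (-t))) with hB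
  set e := ENNReal.ofReal (Real.exp (2 * K * ν))
  have hmA : Measurable A := measurable_wfun hcW _ (measurable_tauWigner τ hf.continuous)
  have hmB : Measurable B := measurable_wfun hcW _ (measurable_tauWigner _ (by fun_prop))
  have : (volume : Measure (E N × E N)).IsAddLeftInvariant :=
    inferInstanceAs ((volume : Measure (E N)).prod volume).IsAddLeftInvariant
  have : (volume : Measure (E N × E N)).IsNegInvariant :=
    ⟨((Measure.measurePreserving_neg (volume : Measure (E N))).prod
      (Measure.measurePreserving_neg (volume : Measure (E N)))).map_eq⟩
  have hY := eLpNorm_lconv_le (m := (volume : Measure (E N × E N))) hmA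
    (B := fun z => e * B z) (by fun_prop) hp
  have h1 : eLpNorm (wfun W ν (stft g f)) (2 * p) volume ^ 2 =
      eLpNorm (fun z => wfun W ν (stft g f) z ^ (2 : ℝ)) p volume := by
    have := eLpNorm_enorm_rpow (μ := (volume : Measure (E N × E N))) (p := p)
      (wfun W ν (stft g f)) (q := 2) two_pos
    simp only [enorm_eq_self] at this
    rw [this, mul_comm p]
    simp
  -- The factor `(2π)^N ≥ 1` in front of the spectrogram is discarded.
  have hone : 1 ≤ ENNReal.ofReal ((2 * Real.pi) ^ N) := by
    rw [← ENNReal.ofReal_one]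
    exact ENNReal.ofReal_le_ofReal (one_le_pow₀ (by linarith [Real.pi_gt_three]))
  have h2 : ∀ z, wfun W ν (stft g f) z ^ (2 : ℝ) ≤ ∫⁻ w, A w * (e * B (z - w)) := by
    intro z
    have hc := enorm_stft_sq_le hω hτ0 hτ1 hf hcg hg.integrable hC z
    have hc' : ‖stft g f z‖ₑ ^ 2 ≤ ∫⁻ w, ‖tauWigner τ f w‖ₑ *
        ‖tauWigner (1 - τ) (fun t => g (-t)) (z - w)‖ₑ :=
      le_trans (le_mul_of_one_le_left zero_le hone) hc
    rw [ENNReal.rpow_ofNat, wfun, mul_pow, ← ENNReal.ofReal_pow (Real.exp_pos _).le]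
    refine (mul_le_mul_right hc' _).trans ?_
    rw [← lintegral_const_mul' _ _ ENNReal.ofReal_ne_top]
    refine lintegral_mono fun w => ?_
    have hE : ENNReal.ofReal (Real.exp (ν * W z) ^ 2) ≤ e *
        (ENNReal.ofReal (Real.exp (2 * K * ν * W (z - w))) *
          ENNReal.ofReal (Real.exp (2 * K * ν * W w))) := by
      rw [← ENNReal.ofReal_mul (Real.exp_pos _).le, ← Real.exp_add, ← Real.exp_nat_mul]
      apply ofReal_exp_le_mul
      have := mul_le_mul_of_nonneg_left (hω.phaseNorm_le z w) hν
      simp only [hW]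
      push_cast
      linarith
    refine (mul_le_mul_left hE _).trans_eq ?_
    rw [hA, hB, wfun, wfun]
    ring
  rw [h1]
  refine (eLpNorm_mono_enorm fun z => by simpa only [enorm_eq_self] using h2 z).trans
    (hY.trans_eq ?_)
  have hA' : eLpNorm A p volume = wnorm2 ω (2 * K * ν) p (tauWigner τ f) := by
    refine eLpNorm_congr_enorm_ae (.of_forall fun z => ?_)
    rw [enorm_exp_mul]; rfl
  have hB' : ∫⁻ z, B z = wnorm2 ω (2 * K * ν) 1 (tauWigner (1 - τ) (fun t => g (-t))) := by
    rw [wnorm2, eLpNorm_one_eq_lintegral_enorm]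
    refine lintegral_congr fun z => ?_
    rw [enorm_exp_mul]; rfl
  rw [hA', lintegral_const_mul _ hmB, hB']

/-- Hölder with exponent `2p`, because Young controls the square of `stft g f` in `L^p`. -/
lemma lintegral_wfun_stft_le (hω : IsWeight ω K b) {p : ℝ≥0∞} (hp : 1 ≤ p) {f g : E N → ℂ}
    (hf : Continuous f) (hg : Continuous g) (a μ : ℝ) :
    ∫⁻ z, wfun (fun z => ω (phaseNorm z)) a (stft g f) z ≤
      eLpNorm (wfun (fun z => ω (phaseNorm z)) (a + μ) (stft g f)) (2 * p) volume *
        wnorm2 (N := N) ω (-μ) (2 * p).conjExponent (fun _ => 1) := by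
  set W : E N × E N → ℝ := fun z => ω (phaseNorm z) with hW
  have hcW : Continuous W := hω.continuous_phaseNorm
  have hmV := measurable_stft hg hf
  have hmW := hcW.measurable
  have := ENNReal.HolderConjugate.conjExponent (p := 2 * p) (hp.trans (by
    rw [two_mul]; exact le_self_add))
  have hH := eLpNorm_smul_le_mul_eLpNorm (μ := (volume : Measure (E N × E N))) (p := 2 * p)
      (q := (2 * p).conjExponent) (r := 1) (f := fun z => (Real.exp (-μ * W z) : ℂ) * 1)
      (φ := fun z => (Real.exp ((a + μ) * W z) : ℂ) * stft g f z)
      (by fun_prop) (by fun_prop)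
  rw [eLpNorm_one_eq_lintegral_enorm] at hH
  have h1 : eLpNorm (wfun W (a + μ) (stft g f)) (2 * p) volume =
      eLpNorm (fun z => (Real.exp ((a + μ) * W z) : ℂ) * stft g f z) (2 * p) volume := by
    refine eLpNorm_congr_enorm_ae (.of_forall fun z => ?_)
    rw [enorm_exp_mul]; rfl
  rw [h1]
  refine le_trans (lintegral_mono fun z => ?_) hH
  rw [Pi.smul_apply', smul_eq_mul, enorm_mul, enorm_exp_mul, enorm_exp_mul, wfun]
  calc _ ≤ (ENNReal.ofReal (Real.exp ((a + μ) * W z)) * ENNReal.ofReal (Real.exp (-μ * W z))) *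
        ‖stft g f z‖ₑ := by
        gcongr
        apply ofReal_exp_le_mul
        ring_nf
        exact le_rfl
    _ = _ := by simp; ring

lemma lintegral_sq_ne_zero {g : E N → ℂ} (hg : Continuous g) (h0 : g ≠ 0) :
    ∫⁻ t, ‖g t‖ₑ ^ 2 ≠ 0 := by
  intro h
  rw [lintegral_eq_zero_iff (by have := hg.measurable; fun_prop)] at h
  apply h0
  have h2 : g =ᵐ[volume] 0 := by
    filter_upwards [h] with t ht
    simpa using ht
  exact (hg.ae_eq_iff_eq volume continuous_zero).1 h2

lemma eLpNorm_two_pow_four (g : E N → ℂ) :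
    eLpNorm g 2 volume ^ 4 = (∫⁻ t, ‖g t‖ₑ ^ 2) ^ 2 := by
  have h : eLpNorm g 2 volume ^ 2 = ∫⁻ t, ‖g t‖ₑ ^ 2 := by
    have := eLpNorm_nnreal_pow_eq_lintegral (f := g) (μ := (volume : Measure (E N)))
      (p := 2) (by norm_num)
    simpa only [NNReal.coe_ofNat, ENNReal.coe_ofNat, ENNReal.rpow_ofNat] using this
  rw [← h, ← pow_mul]

theorem wnorm2_rihaczek_le_window (hω : IsWeight ω K b) {p : ℝ≥0∞} (hp : 1 ≤ p) {τ : ℝ}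
    (hτ0 : 0 < τ) (hτ1 : τ < 1) {s μ : ℝ} (hs : 0 ≤ s) (hμ : 0 ≤ μ) {f g : E N → ℂ}
    (hf : MemS ω f) (hg : MemS ω g) (hg0 : g ≠ 0) :
    wnorm2 ω s ⊤ (rihaczek f) ≤
      (D2 ω K p s μ g * ENNReal.ofReal (Real.exp (2 * K * (K ^ 2 * s + μ)))
        * wnorm2 ω (2 * K * (K ^ 2 * s + μ)) 1 (tauWigner (1 - τ) (fun t => g (-t)))) *
      wnorm2 ω (2 * K * (K ^ 2 * s + μ)) p (tauWigner τ f) := by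
  have hn0 := lintegral_sq_ne_zero hg.continuous hg0
  have hnt : ∫⁻ t, ‖g t‖ₑ ^ 2 ≠ ⊤ := by
    have h := ((hg.rapidDecay hω).memLp (m := (volume : Measure (E N))) hω (fun _ => le_rfl)
      hg.continuous.aestronglyMeasurable 2).2
    intro h2
    have h4 := eLpNorm_two_pow_four g
    rw [h2] at h4
    exact (ENNReal.pow_lt_top h).ne (h4.trans (by simp))
  rw [wnorm2, eLpNorm_exponent_top]
  refine eLpNormEssSup_le_of_ae_enorm_bound (.of_forall fun z => ?_)
  rw [enorm_exp_mul]
  have h1 := wfun_rihaczek_le_stft hω hs hf hg z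
  have h2 := lintegral_wfun_stft_le hω hp hf.continuous hg.continuous (K ^ 2 * s) μ
  have h3 := eLpNorm_stft_sq_le hω hp hτ0 hτ1 (ν := K ^ 2 * s + μ) (by positivity) hf hg
  set c := ENNReal.ofReal ((2 * Real.pi) ^ (2 * N)) with hc
  have hc0 : c ≠ 0 := by simp only [hc, ne_eq, ENNReal.ofReal_eq_zero, not_le]; positivity
  have hct : c ≠ ⊤ := ENNReal.ofReal_ne_top
  set n := ∫⁻ t, ‖g t‖ₑ ^ 2
  set J := ∫⁻ z, wfun (fun z => ω (phaseNorm z)) (K ^ 2 * s) (stft g f) z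
  set Q := wnorm2 (N := N) ω (-μ) (2 * p).conjExponent (fun _ => 1)
  set Y := eLpNorm (wfun (fun z => ω (phaseNorm z)) (K ^ 2 * s + μ) (stft g f)) (2 * p) volume
  set e := ENNReal.ofReal (Real.exp (2 * K * (K ^ 2 * s + μ)))
  set R := wnorm2 ω (2 * K * (K ^ 2 * s + μ)) 1 (tauWigner (1 - τ) (fun t => g (-t)))
  set T := wnorm2 ω (2 * K * (K ^ 2 * s + μ)) p (tauWigner τ f)
  have hJ : J ^ 2 ≤ Q ^ 2 * (T * (e * R)) := by
    calc J ^ 2 ≤ (Y * Q) ^ 2 := by gcongr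
      _ = Q ^ 2 * Y ^ 2 := by ring
      _ ≤ _ := by gcongr
  rw [D2, eLpNorm_two_pow_four]
  rw [← hc]
  change wfun (fun z => ω (phaseNorm z)) s (rihaczek f) z ≤ _
  rw [← ENNReal.le_div_iff_mul_le (by simp [hc0, hn0]) (by
    left; exact ENNReal.mul_ne_top hct (ENNReal.pow_ne_top hnt))] at h1
  refine h1.trans ?_
  rw [div_eq_mul_inv, div_eq_mul_inv]
  set i := (c * n ^ 2)⁻¹
  set e' := ENNReal.ofReal (Real.exp (K * (1 + 2 * K) * s))
  calc _ ≤ e' * wnorm ω (K ^ 2 * s) ⊤ g * wnorm ω (K ^ 2 * s) ⊤ (fourierT g) *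
        (Q ^ 2 * (T * (e * R))) * i := by gcongr
    _ = _ := by ring

/-! ### The Gaussian as an admissible window. -/

/-- The Gaussian `e^{-|x|²/2}`. -/
def gaussian (N : ℕ) (x : E N) : ℂ := (Real.exp (-(‖x‖ ^ 2 / 2)) : ℝ)

lemma hasFDerivAt_gaussian (x : E N) :
    HasFDerivAt (gaussian N)
      (Complex.ofRealCLM.comp (Real.exp (-(‖x‖ ^ 2 / 2)) • -((2⁻¹ : ℝ) • (2 • innerSL ℝ x)))) x := by
  have h1 : HasFDerivAt (fun x : E N => ‖x‖ ^ 2) (2 • innerSL ℝ x) x :=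
    (hasStrictFDerivAt_norm_sq x).hasFDerivAt
  have h2 := ((h1.const_mul (2⁻¹ : ℝ)).neg).exp
  have h3 := Complex.ofRealCLM.hasFDerivAt.comp x h2
  convert! h3 using 1
  · ext y
    simp [gaussian, div_eq_inv_mul]
  · simp [div_eq_inv_mul]

lemma contDiff_gaussian : ContDiff ℝ (⊤ : ℕ∞) (gaussian N) := by
  refine Complex.ofRealCLM.contDiff.comp (Real.contDiff_exp.comp ?_)
  exact ((contDiff_norm_sq ℝ).div_const 2).neg

lemma hasTemperateGrowth_fderiv_apply {h : E N → ℂ} (hh : h.HasTemperateGrowth) (v : E N) :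
    Function.HasTemperateGrowth fun x => fderiv ℝ h x v := by
  have h1 : Function.HasTemperateGrowth (fderiv ℝ h) := by
    refine ⟨hh.1.fderiv_right (m := (⊤ : ℕ∞)) (by simp), fun n => ?_⟩
    obtain ⟨k, C, hC⟩ := hh.2 (n + 1)
    exact ⟨k, C, fun x => by rw [norm_iteratedFDeriv_fderiv]; exact hC x⟩
  exact (ContinuousLinearMap.apply ℝ ℂ v).hasTemperateGrowth.comp h1

/-- Temperate functions times the Gaussian are stable under differentiation, which handles all
multi-indices by induction. -/
lemma partialDeriv_mul_gaussian {h : E N → ℂ} (hh : h.HasTemperateGrowth) (i : Fin N) :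
    ∃ h' : E N → ℂ, h'.HasTemperateGrowth ∧
      partialDeriv i (fun x => h x * gaussian N x) = fun x => h' x * gaussian N x := by
  refine ⟨fun x => fderiv ℝ h x (EuclideanSpace.single i 1) -
    h x * ((inner ℝ x (EuclideanSpace.single i 1) : ℝ) : ℂ), ?_, ?_⟩
  · have h1 : Function.HasTemperateGrowth fun x : E N =>
        ((inner ℝ x (EuclideanSpace.single i 1) : ℝ) : ℂ) :=
      Function.HasTemperateGrowth.comp Function.Complex.hasTemperateGrowth_ofReal (Function.hasTemperateGrowth_inner_left _)
    exact (hasTemperateGrowth_fderiv_apply hh _).sub (hh.mul h1)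
  · ext x
    have hd := ((hh.1.differentiable (by simp)) x).hasFDerivAt.mul (hasFDerivAt_gaussian x)
    have hd' : HasFDerivAt (fun x => h x * gaussian N x) _ x := hd
    rw [partialDeriv, hd'.fderiv]
    simp [gaussian]
    ring

lemma iterPartialDeriv_mul_gaussian {h : E N → ℂ} (hh : h.HasTemperateGrowth) (l : List (Fin N)) :
    ∃ h' : E N → ℂ, h'.HasTemperateGrowth ∧
      iterPartialDeriv l (fun x => h x * gaussian N x) = fun x => h' x * gaussian N x := by
  induction l with
  | nil => exact ⟨h, hh, rfl⟩
  | cons i l ih =>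
    obtain ⟨h₁, hh₁, he⟩ := ih
    obtain ⟨h₂, hh₂, he₂⟩ := partialDeriv_mul_gaussian hh₁ i
    refine ⟨h₂, hh₂, ?_⟩
    rw [← he₂, ← he]
    rfl

/-- The only use of (β): linear growth of `ω` loses against the Gaussian exponent. -/
lemma IsWeight.exists_le_add (hω : IsWeight ω K b) : ∃ M, 0 ≤ M ∧ ∀ t, 0 ≤ t → ω t ≤ t + M := by
  obtain ⟨T, hT⟩ := eventually_atTop.1 (hω.beta.bound zero_lt_one)
  have hM := hω.nonneg (max T 0) (le_max_right _ _)
  refine ⟨ω (max T 0), hM, fun t ht => ?_⟩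
  rcases le_total t (max T 0) with h | h
  · linarith [hω.mono ht h]
  · have := hT t ((le_max_left _ _).trans h)
    rw [one_mul, Real.norm_of_nonneg (hω.nonneg t ht), Real.norm_of_nonneg ht] at this
    linarith

lemma bound_mul_gaussian (hω : IsWeight ω K b) {h : E N → ℂ} (hh : h.HasTemperateGrowth) {s : ℝ}
    (hs : 0 < s) : ∃ C : ℝ, ∀ x : E N, Real.exp (s * ω ‖x‖) * ‖h x * gaussian N x‖ ≤ C := by
  obtain ⟨M, hM0, hM⟩ := hω.exists_le_add
  obtain ⟨k, C, hC⟩ := hh.2 0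
  simp only [norm_iteratedFDeriv_zero] at hC
  have hC0 : 0 ≤ C := by simpa using (norm_nonneg _).trans (hC 0)
  -- Completing the square: `(s+k)r - r²/2 ≤ (s+k)²/2`.
  refine ⟨C * Real.exp (s * M + (s + k) ^ 2 / 2), fun x => ?_⟩
  have h1 : (1 + ‖x‖) ^ k ≤ Real.exp (k * ‖x‖) := by
    rw [Real.exp_nat_mul]
    exact pow_le_pow_left₀ (by positivity) (by linarith [Real.add_one_le_exp ‖x‖]) k
  have h2 := mul_le_mul_of_nonneg_left (hM _ (norm_nonneg x)) hs.le
  rw [norm_mul, gaussian, Complex.norm_real, Real.norm_of_nonneg (Real.exp_pos _).le]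
  calc _ ≤ Real.exp (s * (‖x‖ + M)) *
        (C * Real.exp (k * ‖x‖) * Real.exp (-(‖x‖ ^ 2 / 2))) := by
        gcongr
        exact (hC x).trans (by gcongr)
    _ = C * Real.exp (s * (‖x‖ + M) + k * ‖x‖ + -(‖x‖ ^ 2 / 2)) := by
        rw [Real.exp_add, Real.exp_add]; ring
    _ ≤ _ := by
        refine mul_le_mul_of_nonneg_left (Real.exp_le_exp.2 ?_) hC0
        nlinarith [sq_nonneg (‖x‖ - (s + k))]

lemma fourierT_gaussian : ∃ c : ℂ, fourierT (gaussian N) = fun ξ => c * gaussian N ξ := by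
  refine ⟨(Real.pi / (1 / 2 : ℂ)) ^ (Module.finrank ℝ (E N) / 2 : ℂ), ?_⟩
  ext ξ
  have h := fourier_gaussian_innerProductSpace (V := E N) (b := 1 / 2) (by norm_num)
    ((2 * Real.pi)⁻¹ • ξ)
  have hg : gaussian N = fun v => Complex.exp (-(1 / 2) * ‖v‖ ^ 2) := by
    ext v
    rw [gaussian]
    push_cast
    ring_nf
  rw [fourierT_eq_fourier, hg, h]
  congr 2
  rw [norm_smul, Real.norm_of_nonneg (by positivity)]
  have : (Real.pi : ℂ) ≠ 0 := by exact_mod_cast Real.pi_ne_zero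
  push_cast
  field_simp

lemma memS_gaussian (hω : IsWeight ω K b) : MemS ω (gaussian N) := by
  obtain ⟨c, hc⟩ := fourierT_gaussian (N := N)
  have hone : gaussian N = fun x => (1 : ℂ) * gaussian N x := by simp
  have hb : ∀ a : ℂ, ∀ s : ℝ, 0 < s → ∀ l : List (Fin N), ∃ C : ℝ, ∀ x,
      Real.exp (s * ω ‖x‖) * ‖iterPartialDeriv l (fun x => a * gaussian N x) x‖ ≤ C := by
    intro a s hs l
    obtain ⟨h, hh, he⟩ := iterPartialDeriv_mul_gaussian (N := N)
      (Function.HasTemperateGrowth.const a) l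
    rw [he]
    exact bound_mul_gaussian hω hh hs
  have hb1 : ∀ s : ℝ, 0 < s → ∀ l : List (Fin N), ∃ C : ℝ, ∀ x,
      Real.exp (s * ω ‖x‖) * ‖iterPartialDeriv l (gaussian N) x‖ ≤ C := by
    rw [hone]; exact hb 1
  refine ⟨?_, contDiff_gaussian, ?_, hb1, ?_⟩
  · have hd : RapidDecay (fun x : E N => ω ‖x‖) (gaussian N) :=
      .of_pos (fun x => hω.nonneg _ (norm_nonneg x)) fun s hs => hb1 s hs []
    exact memLp_one_iff_integrable.1 (hd.memLp hω (fun _ => le_rfl)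
      contDiff_gaussian.continuous.aestronglyMeasurable 1)
  · rw [hc]; exact contDiff_const.mul contDiff_gaussian
  · rw [hc]; exact hb c

lemma gaussian_ne_zero : gaussian N ≠ 0 := by
  intro h
  have := congrFun h 0
  simp [gaussian] at this

lemma gaussian_comp_neg : (fun t => gaussian N (-t)) = gaussian N := by
  ext t; simp [gaussian]

/-! ### Finiteness of `D4` and passage to the infimum. -/

lemma conjExponent_two_mul_ne_top {p : ℝ≥0∞} (hp : 1 ≤ p) : (2 * p).conjExponent ≠ ⊤ := by
  have h2 : (1 : ℝ≥0∞) < 2 * p := lt_of_lt_of_le (by norm_num) (mul_le_mul_right hp 2)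
  rw [ENNReal.conjExponent]
  simp [tsub_eq_zero_iff_le, h2]

lemma D4_lt_top (hω : IsWeight ω K b) {p : ℝ≥0∞} (hp : 1 ≤ p) {τ : ℝ} (hτ0 : 0 < τ)
    (hτ1 : τ < 1) (s : ℝ) {μ : ℝ}
    (hμ : 2 * (N : ℝ) / (b * (2 * p).conjExponent.toReal) < μ) :
    D4 N ω K τ p s μ < ⊤ := by
  have hg := memS_gaussian (N := N) hω
  refine lt_of_le_of_lt (iInf_le_of_le (gaussian N) (iInf_le_of_le hg
    (iInf_le _ gaussian_ne_zero))) ?_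
  rw [gaussian_comp_neg]
  have hW := wnorm2_lt_top hω (rapidDecay_tauWigner hω (τ := 1 - τ) (by linarith) (by linarith) hg)
    (2 * K * (K ^ 2 * s + μ)) 1
  refine ENNReal.mul_lt_top (ENNReal.mul_lt_top ?_ ENNReal.ofReal_lt_top) hW
  have hQ : wnorm2 (N := N) ω (-μ) (2 * p).conjExponent (fun _ => 1) < ⊤ := by
    rw [wnorm2]
    simp only [mul_one]
    refine hω.eLpNorm_exp_neg_lt_top (m := (volume : Measure (E N)).prod volume)
      (w := fun z => ω (phaseNorm z))
      (fun z => hω.mono (norm_nonneg z) (norm_le_phaseNorm z)) ?_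
      (conjExponent_two_mul_ne_top hp) ?_
    · simp [ENNReal.conjExponent]
    · rw [Module.finrank_prod, finrank_euclideanSpace_fin]
      push_cast
      rwa [← two_mul]
  have h1 : wnorm ω (K ^ 2 * s) ⊤ (gaussian N) < ⊤ :=
    (hg.rapidDecay hω).eLpNorm_lt_top hω (fun _ => le_rfl) _ _
  have h2 : wnorm ω (K ^ 2 * s) ⊤ (fourierT (gaussian N)) < ⊤ :=
    (hg.rapidDecay_fourierT hω).eLpNorm_lt_top hω (fun _ => le_rfl) _ _
  rw [D2]
  refine ENNReal.div_lt_top (ENNReal.mul_lt_top (ENNReal.mul_lt_top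
    (ENNReal.mul_lt_top ENNReal.ofReal_lt_top h1) h2) (ENNReal.pow_lt_top hQ)).ne ?_
  rw [eLpNorm_two_pow_four]
  refine mul_ne_zero ?_ (pow_ne_zero _ (lintegral_sq_ne_zero hg.continuous gaussian_ne_zero))
  simp only [ne_eq, ENNReal.ofReal_eq_zero, not_le]
  positivity

theorem wnorm2_rihaczek_le (hω : IsWeight ω K b) {p : ℝ≥0∞} (hp : 1 ≤ p) {τ : ℝ}
    (hτ0 : 0 < τ) (hτ1 : τ < 1) {s μ : ℝ} (hs : 0 ≤ s)
    (hμ : 2 * (N : ℝ) / (b * (2 * p).conjExponent.toReal) < μ) {f : E N → ℂ} (hf : MemS ω f) :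
    wnorm2 ω s ⊤ (rihaczek f) ≤
      D4 N ω K τ p s μ * wnorm2 ω (2 * K * (K ^ 2 * s + μ)) p (tauWigner τ f) := by
  have hb := hω.pos
  have hμ0 : 0 ≤ μ := le_trans (by positivity) hμ.le
  have hT := wnorm2_lt_top hω (rapidDecay_tauWigner hω hτ0 hτ1 hf) (2 * K * (K ^ 2 * s + μ)) p
  -- Dividing by the Wigner norm reduces the claim to a lower bound for an infimum. That norm may
  -- vanish, and then finiteness of `D4` is what validates the division.
  rw [← ENNReal.div_le_iff_le_mul (.inr (D4_lt_top hω hp hτ0 hτ1 s hμ).ne) (.inl hT.ne)]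
  refine le_iInf fun g => le_iInf fun hg => le_iInf fun hg0 => ?_
  exact ENNReal.div_le_of_le_mul (wnorm2_rihaczek_le_window hω hp hτ0 hτ1 hs hμ0 hf hg hg0)

end TimeFreq

end

theorem mainTheorem2 (N : ℕ) (ω : ℝ → ℝ) (K b : ℝ) (hω : TimeFreq.IsWeight ω K b)
    (p : ENNReal) (hp : 1 ≤ p) (τ : ℝ) (hτ0 : 0 < τ) (hτ1 : τ < 1) :
    (∀ s : ℝ, 0 ≤ s → ∀ f : EuclideanSpace ℝ (Fin N) → ℂ, TimeFreq.MemS ω f →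
      TimeFreq.wnorm2 ω (4 * K ^ 2 * s) p (TimeFreq.rihaczek f) < ⊤ ∧
      TimeFreq.wnorm2 ω (4 * K ^ 2 * s) p.conjExponent (TimeFreq.rihaczek f) < ⊤ ∧
      TimeFreq.wnorm2 ω s ⊤ (TimeFreq.tauWigner τ f) ^ 2 ≤
        ENNReal.ofReal (TimeFreq.D3 N K τ s)
          * TimeFreq.wnorm2 ω (4 * K ^ 2 * s) p (TimeFreq.rihaczek f)
          * TimeFreq.wnorm2 ω (4 * K ^ 2 * s) p.conjExponent (TimeFreq.rihaczek f)) ∧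
    (∀ s : ℝ, 0 ≤ s → ∀ μ : ℝ, 2 * (N : ℝ) / (b * (2 * p).conjExponent.toReal) < μ →
      TimeFreq.D4 N ω K τ p s μ < ⊤ ∧
      ∀ f : EuclideanSpace ℝ (Fin N) → ℂ, TimeFreq.MemS ω f →
        TimeFreq.wnorm2 ω (2 * K * (K ^ 2 * s + μ)) p (TimeFreq.tauWigner τ f) < ⊤ ∧
        TimeFreq.wnorm2 ω s ⊤ (TimeFreq.rihaczek f) ≤
          TimeFreq.D4 N ω K τ p s μ
            * TimeFreq.wnorm2 ω (2 * K * (K ^ 2 * s + μ)) p (TimeFreq.tauWigner τ f)) :=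
  ⟨fun _ hs _ hf => ⟨TimeFreq.wnorm2_lt_top hω (TimeFreq.rapidDecay_rihaczek hω hf) _ _,
    TimeFreq.wnorm2_lt_top hω (TimeFreq.rapidDecay_rihaczek hω hf) _ _,
    TimeFreq.tauWigner_bound hω hp hτ0 hτ1 hs hf⟩,
  fun s hs _ hμ => ⟨TimeFreq.D4_lt_top hω hp hτ0 hτ1 s hμ, fun _ hf =>
    ⟨TimeFreq.wnorm2_lt_top hω (TimeFreq.rapidDecay_tauWigner hω hτ0 hτ1 hf) _ _,
    TimeFreq.wnorm2_rihaczek_le hω hp hτ0 hτ1 hs hμ hf⟩⟩⟩
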